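/- Let $0\le M\le L$ be integers. For each complex number $u$ fix a square root $\sqrt u$ (so $(\sqrt u)^2=u$), and read $\sqrt{z/x}=\sqrt z/\sqrt x$, $\sqrt{\mu\xi}=\sqrt\mu\sqrt\xi$, $(xy)^{k/2}=(\sqrt x\sqrt y)^k$ and $\rho^{k/2}=(\sqrt\rho)^k$ for integers $k$. Let $\rho\in\mathbb C\setminus\{0\}$, let $\xi_1,\dots,\xi_L,z_1,\dots,z_L\in\mathbb C$ and $\mu_m,x_m,\nu_m,y_m\in\mathbb C$ ($1\le m\le M$), with $x_m,y_m\ne 0$ and $\mu_m\rho\ne\xi_k$, $\nu_m\rho\ne\xi_k$ for all $m,k$. **The model.** Put $$R\begin{pmatrix}\mu&\xi\\x&z\end{pmatrix}=\begin{pmatrix}1&0&0&0\\0&b_+&c&0\\0&c&b_-&0\\0&0&0&\frac zx\end{pmatrix},\quad b_+=\frac{\sqrt\rho}{x}\,\frac{\mu-\xi}{\mu\rho-\xi},\quad b_-=\sqrt\rho\,z\,\frac{\mu-\xi}{\mu\rho-\xi},\quad c=(\rho-1)\sqrt{\tfrac zx}\,\frac{\sqrt{\mu\xi}}{\mu\rho-\xi},$$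 acting on $\mathbb C^2\otimes\mathbb C^2$ in the basis $e_1\otimes e_1,\ e_1\otimes e_2,\ e_2\otimes e_1,\ e_2\otimes e_2$. Let $V_1=\dots=V_L=\mathbb C^2$, let $a$ be an auxiliary space $\mathbb C^2$, and let $R_{ak}$ be $R$ acting on the auxiliary space (first factor) and $V_k$ (second factor). The operators $A,B,C,D$ on $V_1\otimes\dots\otimes V_L$ are the entries, in the auxiliary space, of the monodromy matrix $$R_{aL}\begin{pmatrix}\mu&\xi_L\\x&z_L\end{pmatrix}\cdots R_{a1}\begin{pmatrix}\mu&\xi_1\\x&z_1\end{pmatrix}=\begin{pmatrix}A\binom{\mu}{x}&B\binom{\mu}{x}\\C\binom{\mu}{x}&D\binom{\mu}{x}\end{pmatrix}_a .$$ With $|1\rangle=e_2\otimes\dots\otimes e_2$ and $\langle1|$ its transpose, the scalar product with free rapidities is $$\mathcal S\begin{pmatrix}\{\mu\}&\{\nu\}\\\{x\}&\{y\}\end{pmatrix}=\langle 1|\,B\tbinom{\mu_1}{x_1}\cdots B\tbinom{\mu_M}{x_M}\,C\tbinom{\nu_M}{y_M}\cdots C\tbinom{\nu_1}{y_1}\,|1\rangle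 .$$ Let $\mathcal S^{(sym)}(\{\mu\},\{\nu\})$ be the scalar product defined in the same way for the symmetric trigonometric six-vertex model, whose $R$-matrix has the weights $a_\pm=1$, $b_\pm=b(\mu,\xi)=\sqrt\rho\,\frac{\mu-\xi}{\mu\rho-\xi}$, $c_\pm=c(\mu,\xi)=(\rho-1)\frac{\sqrt{\mu\xi}}{\mu\rho-\xi}$. **Claim.** $$\mathcal S\begin{pmatrix}\{\mu\}&\{\nu\}\\\{x\}&\{y\}\end{pmatrix}=\frac{\prod_{l=1}^L z_l^M}{\prod_{m=1}^M(x_my_m)^{L+\frac12-m}}\;\mathcal S^{(sym)}(\{\mu\},\{\nu\}).$$ Moreover, if the $\xi_k$ are pairwise distinct, the $\mu_m$ are pairwise distinct, the $\nu_m$ are pairwise distinct, and $\mu_m\neq\xi_k$, $\nu_m\ne\xi_k$ for all $m,k$, then $$\mathcal S^{(sym)}(\{\mu\},\{\nu\})=\rho^{-\frac{M(L-M)}2}\sum_{1\le l_1<\dots<l_M\le L}\ \prod_{m=1}^M\ \prod_{\substack{n=1\\n\ne l_1,\dots,l_M}}^L\frac{\xi_n\rho-\xi_{l_m}}{\xi_n-\xi_{l_m}}\;Z_M(\{\mu\},\{\xi_l\})\,Z_M(\{\nu\},\{\xi_l\}),$$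 where $\{\xi_l\}=(\xi_{l_1},\dots,\xi_{l_M})$ and, for $\eta=(\eta_1,\dots,\eta_M)$, $$Z_M(\{\mu\},\{\eta\})=\frac{\prod_{k=1}^M\sqrt{\mu_k\eta_k}\ \prod_{m,n=1}^M(\mu_m-\eta_n)}{\prod_{1\le p<q\le M}(\mu_p-\mu_q)(\eta_q-\eta_p)}\ \det\left[\frac{\rho-1}{(\mu_i\rho-\eta_j)(\mu_i-\eta_j)}\right]_{i,j=1}^M .$$ -/

import Mathlib

open scoped Matrix

noncomputable section

namespace SixVertex

/-- Boltzmann weights of a six-vertex model normalised by its first weight (`a₊ = 1`). -/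
structure Weights where
  bPlus : ℂ
  bMinus : ℂ
  cPlus : ℂ
  cMinus : ℂ
  aMinus : ℂ

/-- The `4 × 4` matrix `R` acting on `ℂ² ⊗ ℂ²` (first factor: auxiliary space, second factor:
quantum space), in the ordered basis `e₁⊗e₁, e₁⊗e₂, e₂⊗e₁, e₂⊗e₂`; indices are pairs
`(auxiliary, quantum)`. -/
def rMatrix (w : Weights) : Matrix (Fin 2 × Fin 2) (Fin 2 × Fin 2) ℂ :=
  (!![1, 0, 0, 0;
      0, w.bPlus, w.cPlus, 0;
      0, w.cMinus, w.bMinus, 0;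
      0, 0, 0, w.aMinus] : Matrix (Fin (2 * 2)) (Fin (2 * 2)) ℂ).submatrix
    finProdFinEquiv finProdFinEquiv

/-- Labels of the standard product basis of `V₁ ⊗ ⋯ ⊗ V_L`, with `V_k = ℂ²`: the label `s`
stands for `e_{s 1} ⊗ ⋯ ⊗ e_{s L}`. -/
abbrev Config (L : ℕ) := Fin L → Fin 2

/-- Operators on `V₁ ⊗ ⋯ ⊗ V_L`, as matrices in the product basis. -/
abbrev Op (L : ℕ) := Matrix (Config L) (Config L) ℂ

/-- The operator acting as the `2 × 2` matrix `e` on `V_k` and as the identity on the other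
factors. -/
def siteOp {L : ℕ} (k : Fin L) (e : Matrix (Fin 2) (Fin 2) ℂ) : Op L :=
  Matrix.of fun s t => if ∀ j, j ≠ k → s j = t j then e (s k) (t k) else 0

/-- `R_{ak}`, acting on the auxiliary space and on `V_k`, as a `2 × 2` matrix in the auxiliary
space whose entries are operators on `V₁ ⊗ ⋯ ⊗ V_L`. -/
def localOp {L : ℕ} (w : Weights) (k : Fin L) : Matrix (Fin 2) (Fin 2) (Op L) :=
  Matrix.of fun i j => siteOp k (Matrix.of fun p q => rMatrix w (i, p) (j, q))

/-- The monodromy matrix `R_{aL} R_{a(L-1)} ⋯ R_{a1}`, where `R_{ak}` has the weights `w k`. -/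
def monodromy {L : ℕ} (w : Fin L → Weights) : Matrix (Fin 2) (Fin 2) (Op L) :=
  (List.ofFn fun k => localOp (w k) k).reverse.prod

/-- The upper right entry of the monodromy matrix. -/
def opB {L : ℕ} (w : Fin L → Weights) : Op L := monodromy w 0 1

/-- The lower left entry of the monodromy matrix. -/
def opC {L : ℕ} (w : Fin L → Weights) : Op L := monodromy w 1 0

/-- The ferromagnetic state `e₂ ⊗ ⋯ ⊗ e₂`. -/
def refState (L : ℕ) : Config L → ℂ := Pi.single (fun _ => 1) 1

/-- `⟨1| B₁ B₂ ⋯ B_M C_M ⋯ C₂ C₁ |1⟩`, where `B_m` is built from the weights `wB m` and `C_m`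
from the weights `wC m`. -/
def scalarProduct {L M : ℕ} (wB wC : Fin M → Fin L → Weights) : ℂ :=
  refState L ⬝ᵥ
    (((List.ofFn fun m => opB (wB m)).prod * (List.ofFn fun m => opC (wC m)).reverse.prod) *ᵥ
      refState L)

/-- Weights of the trigonometric six-vertex model with anisotropy `ρ`, spectral parameters
`μ, ξ` and electric fields `x, z`. The function `r` is a choice of square roots:
`√ρ = r ρ`, `√(z / x) = r z / r x`, `√(μ ξ) = r μ * r ξ`. -/
def fieldWeights (r : ℂ → ℂ) (ρ μ ξ x z : ℂ) : Weights where
  bPlus := r ρ / x * ((μ - ξ) / (μ * ρ - ξ))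
  bMinus := r ρ * z * ((μ - ξ) / (μ * ρ - ξ))
  cPlus := (ρ - 1) * (r z / r x) * (r μ * r ξ / (μ * ρ - ξ))
  cMinus := (ρ - 1) * (r z / r x) * (r μ * r ξ / (μ * ρ - ξ))
  aMinus := z / x

/-- Weights of the symmetric trigonometric six-vertex model (no electric fields). -/
def symWeights (r : ℂ → ℂ) (ρ μ ξ : ℂ) : Weights where
  bPlus := r ρ * ((μ - ξ) / (μ * ρ - ξ))
  bMinus := r ρ * ((μ - ξ) / (μ * ρ - ξ))
  cPlus := (ρ - 1) * (r μ * r ξ / (μ * ρ - ξ))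
  cMinus := (ρ - 1) * (r μ * r ξ / (μ * ρ - ξ))
  aMinus := 1

/-- The scalar product of the model with electric fields: the additive rapidities are `μ`, `ν`,
the non-additive ones `x`, `y`, and the inhomogeneities are `ξ`, `z`. -/
def fieldScalarProduct (r : ℂ → ℂ) (ρ : ℂ) {L M : ℕ} (ξ z : Fin L → ℂ) (μ x ν y : Fin M → ℂ) : ℂ :=
  scalarProduct (fun m k => fieldWeights r ρ (μ m) (ξ k) (x m) (z k))
    (fun m k => fieldWeights r ρ (ν m) (ξ k) (y m) (z k))

/-- The scalar product of the symmetric trigonometric six-vertex model. -/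
def symScalarProduct (r : ℂ → ℂ) (ρ : ℂ) {L M : ℕ} (ξ : Fin L → ℂ) (μ ν : Fin M → ℂ) : ℂ :=
  scalarProduct (fun m k => symWeights r ρ (μ m) (ξ k)) (fun m k => symWeights r ρ (ν m) (ξ k))

/-- The Izergin determinant expression. -/
def izergin (r : ℂ → ℂ) (ρ : ℂ) {M : ℕ} (μ ξ : Fin M → ℂ) : ℂ :=
  ((∏ k, r (μ k) * r (ξ k)) * ∏ m, ∏ n, (μ m - ξ n)) /
      (∏ p, ∏ q with p < q, (μ p - μ q) * (ξ q - ξ p)) *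
    (Matrix.of fun i j => (ρ - 1) / ((μ i * ρ - ξ j) * (μ i - ξ j))).det

end SixVertex

end

/-! Electric fields. A field only multiplies each vertex by powers of `α` and `β` read off from its
edges. The ice rule turns the exponents of `β` into a difference between incoming and outgoing
states, so a diagonal gauge transformation absorbs them, up to a global factor. The exponents of `α`
merely count the sites in state `e₂`, and that count is known at every stage of the scalar product
(`scalarProduct_twist`).

Sum formula. With `R` a permutation at equal spectral parameters, a factorizing (Drinfeld twist)
basis is built site by site: a vector `ψ` on `n` sites is extended either to `ψ ⊗ e₁` or to `D(s_n)
ψ ⊗ e₂ + B(s_n) ψ ⊗ e₁`. In this basis `D` is diagonal with product eigenvalues, and `B` is a sum of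
terms each removing one site from the label (`monodromy_factorVec`). Transposition combined with
reversal of the chain yields the dual basis, hence a resolution of the identity
(`sum_mul_eq_sum_factorVec`).

Inserting it between the `B` and the `C` operators splits the scalar product into a sum over subsets
of sites. Each summand is a product of two domain wall partition functions divided by the pairing. A
partition function obeys the recursion "the last `B` removes one site", and the Izergin determinant
obeys the same recursion by Laplace expansion and Lagrange interpolation (`izerginRat_snoc`,
`wallSum_rangeConfig`).

The basis needs inhomogeneities in general position, and the gauge needs nonzero `z`. Both
restrictions are lifted by perturbing the square roots and using continuity. -/

noncomputable section

namespace SixVertex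

/-! ### Recursions for the monodromy matrix -/

/-- The operator on `n + 1` sites acting as `X` on the first `n` sites. -/
def liftOp (n : ℕ) : Op n →+* Op (n + 1) where
  toFun X := Matrix.of fun s t =>
    if s (Fin.last n) = t (Fin.last n) then X (s ∘ Fin.castSucc) (t ∘ Fin.castSucc) else 0
  map_one' := by
    ext s t
    by_cases h : s = t
    · subst h; simp
    · have : ¬ (s (Fin.last n) = t (Fin.last n) ∧ s ∘ Fin.castSucc = t ∘ Fin.castSucc) := by
        rintro ⟨h1, h2⟩
        apply h
        funext k
        refine Fin.lastCases h1 (fun i => congrFun h2 i) k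
      simp only [Matrix.of_apply, Matrix.one_apply, h, if_false]
      grind
  map_zero' := by ext s t; simp
  map_add' X Y := by
    ext s t
    simp only [Matrix.of_apply, Matrix.add_apply]
    split_ifs <;> simp
  map_mul' X Y := by
    ext s t
    simp only [Matrix.of_apply, Matrix.mul_apply]
    rw [← (Fin.snocEquiv (fun _ : Fin (n + 1) => Fin 2)).sum_comp, Fintype.sum_prod_type]
    simp only [Fin.snocEquiv, Equiv.coe_fn_mk, Fin.snoc_last]
    have (p : Fin 2) (u : Fin n → Fin 2) :
        (Fin.snoc u p : Fin (n + 1) → Fin 2) ∘ Fin.castSucc = u := by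
      funext k; simp
    by_cases h : s (Fin.last n) = t (Fin.last n)
    · rw [Finset.sum_eq_single (s (Fin.last n))]
      · simp [this, h]
      · intro p _ hp
        simp [Ne.symm hp]
      · simp
    · simp only [h, if_false]
      symm
      apply Finset.sum_eq_zero
      intro p _
      apply Finset.sum_eq_zero
      intro u _
      grind

theorem liftOp_apply {n : ℕ} (X : Op n) (s t : Config (n + 1)) :
    liftOp n X s t =
      if s (Fin.last n) = t (Fin.last n) then X (s ∘ Fin.castSucc) (t ∘ Fin.castSucc) else 0 :=
  rfl

theorem liftOp_siteOp {n : ℕ} (k : Fin n) (e : Matrix (Fin 2) (Fin 2) ℂ) :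
    liftOp n (siteOp k e) = siteOp k.castSucc e := by
  ext s t
  simp only [liftOp_apply, siteOp, Matrix.of_apply, Function.comp]
  rw [← ite_and]
  congr 1
  simp only [Fin.forall_fin_succ', eq_iff_iff]
  simp only [ne_eq, Fin.castSucc_inj, not_false_eq_true, true_imp_iff,
    (Fin.castSucc_lt_last k).ne']
  tauto

theorem mapMatrix_localOp {n : ℕ} (w : Weights) (k : Fin n) :
    (liftOp n).mapMatrix (localOp w k) = localOp w k.castSucc := by
  ext1 i j
  simp [localOp, liftOp_siteOp]

theorem monodromy_succ {n : ℕ} (w : Fin (n + 1) → Weights) :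
    monodromy w = localOp (w (Fin.last n)) (Fin.last n) *
      (liftOp n).mapMatrix (monodromy (w ∘ Fin.castSucc)) := by
  rw [monodromy, monodromy, List.ofFn_succ', List.concat_eq_append, List.reverse_append, map_list_prod,
    List.map_reverse, List.map_ofFn]
  simp only [Function.comp_def, mapMatrix_localOp, List.reverse_singleton, List.singleton_append,
    List.prod_cons]

theorem siteOp_last_mul_liftOp {n : ℕ} (e : Matrix (Fin 2) (Fin 2) ℂ) (X : Op n)
    (s t : Config (n + 1)) :
    (siteOp (Fin.last n) e * liftOp n X) s t =
      e (s (Fin.last n)) (t (Fin.last n)) * X (s ∘ Fin.castSucc) (t ∘ Fin.castSucc) := by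
  rw [Matrix.mul_apply, Finset.sum_eq_single (Fin.snoc (s ∘ Fin.castSucc) (t (Fin.last n)))]
  · have : (Fin.snoc (s ∘ Fin.castSucc) (t (Fin.last n)) : Fin (n + 1) → Fin 2) ∘ Fin.castSucc
        = s ∘ Fin.castSucc := by
      funext k; simp
    simp only [siteOp, Matrix.of_apply, liftOp_apply, this, Fin.snoc_last, if_true]
    rw [if_pos]
    intro j hj
    obtain ⟨i, rfl⟩ := Fin.exists_castSucc_eq.2 hj
    simp
  · intro u _ hu
    simp only [siteOp, Matrix.of_apply, liftOp_apply]
    split_ifs with h1 h2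
    · exfalso
      apply hu
      funext k
      refine Fin.lastCases ?_ (fun i => ?_) k
      · simp [h2]
      · simp [h1 i.castSucc (Fin.castSucc_lt_last i).ne]
    all_goals simp
  · simp

theorem monodromy_snoc {n : ℕ} (w : Fin (n + 1) → Weights) (i j : Fin 2) (s t : Config (n + 1)) :
    monodromy w i j s t = ∑ l, rMatrix (w (Fin.last n)) (i, s (Fin.last n)) (l, t (Fin.last n)) *
      monodromy (w ∘ Fin.castSucc) l j (s ∘ Fin.castSucc) (t ∘ Fin.castSucc) := by
  rw [monodromy_succ, Matrix.mul_apply, Matrix.sum_apply]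
  simp [localOp, siteOp_last_mul_liftOp]

theorem monodromy_zero (w : Fin 0 → Weights) (i j : Fin 2) (s t : Config 0) :
    monodromy w i j s t = if i = j then 1 else 0 := by
  rw [Subsingleton.elim s t]
  simp only [monodromy, List.ofFn_zero, List.reverse_nil, List.prod_nil, Matrix.one_apply]
  split_ifs <;> simp

/-- Associativity of the ordered product: the first site is the rightmost factor. Together with
`monodromy_snoc` this lets reversal exchange the two ends of the chain. -/
theorem monodromy_cons {n : ℕ} (w : Fin (n + 1) → Weights) (i j : Fin 2) (s t : Config (n + 1)) :
    monodromy w i j s t = ∑ l, monodromy (w ∘ Fin.succ) i l (s ∘ Fin.succ) (t ∘ Fin.succ) *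
      rMatrix (w 0) (l, s 0) (j, t 0) := by
  induction n generalizing i j with
  | zero =>
    rw [monodromy_snoc]
    simp [monodromy_zero]
  | succ n ih =>
    rw [monodromy_snoc]
    simp only [ih (w ∘ Fin.castSucc), monodromy_snoc (w ∘ Fin.succ), Finset.mul_sum, Finset.sum_mul]
    rw [Finset.sum_comm]
    refine Finset.sum_congr rfl fun l _ => ?_
    refine Finset.sum_congr rfl fun l' _ => ?_
    simp only [Function.comp_def, Fin.succ_castSucc, Fin.succ_last, mul_assoc, Fin.castSucc_zero]

theorem rMatrix_eq (w : Weights) (i p j q : Fin 2) :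
    rMatrix w (i, p) (j, q) =
      if i = 0 ∧ p = 0 ∧ j = 0 ∧ q = 0 then 1
      else if i = 0 ∧ p = 1 ∧ j = 0 ∧ q = 1 then w.bPlus
      else if i = 0 ∧ p = 1 ∧ j = 1 ∧ q = 0 then w.cPlus
      else if i = 1 ∧ p = 0 ∧ j = 0 ∧ q = 1 then w.cMinus
      else if i = 1 ∧ p = 0 ∧ j = 1 ∧ q = 0 then w.bMinus
      else if i = 1 ∧ p = 1 ∧ j = 1 ∧ q = 1 then w.aMinus else 0 := by
  fin_cases i <;> fin_cases p <;> fin_cases j <;> fin_cases q <;>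
    simp [rMatrix, finProdFinEquiv]

theorem rMatrix_symm (w : Weights) (h : w.cPlus = w.cMinus) (a b : Fin 2 × Fin 2) :
    rMatrix w a b = rMatrix w b a := by
  obtain ⟨i, p⟩ := a
  obtain ⟨j, q⟩ := b
  fin_cases i <;> fin_cases p <;> fin_cases j <;> fin_cases q <;> simp [rMatrix_eq, h]

/-- Transposition of the monodromy matrix reverses the order of the sites. -/
theorem monodromy_rev {n : ℕ} (w : Fin n → Weights) (hw : ∀ k, (w k).cPlus = (w k).cMinus)
    (i j : Fin 2) (s t : Config n) :
    monodromy w i j s t = monodromy (w ∘ Fin.rev) j i (t ∘ Fin.rev) (s ∘ Fin.rev) := by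
  induction n generalizing i j with
  | zero => simp [monodromy_zero, eq_comm]
  | succ n ih =>
    rw [monodromy_snoc, monodromy_cons]
    refine Finset.sum_congr rfl fun l _ => ?_
    rw [ih (w ∘ Fin.castSucc) (fun k => hw _), mul_comm, rMatrix_symm _ (hw _)]
    simp [Function.comp_def, Fin.rev_succ]

theorem rMatrix_ice (w : Weights) {i p j q : Fin 2} (h : rMatrix w (i, p) (j, q) ≠ 0) :
    (i : ℕ) + p = j + q := by
  rw [rMatrix_eq] at h
  fin_cases i <;> fin_cases p <;> fin_cases j <;> fin_cases q <;> simp_all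

/-- The number of sites in the state `e₂`. -/
def downCount {n : ℕ} (s : Config n) : ℕ := ∑ k, (s k : ℕ)

theorem downCount_succ {n : ℕ} (s : Config (n + 1)) :
    downCount s = downCount (s ∘ Fin.castSucc) + s (Fin.last n) := by
  simp [downCount, Fin.sum_univ_castSucc]

/-- Conservation at single vertices telescopes along the row. In particular `B` and `C` change the
number of sites in state `e₂` by exactly one. -/
theorem monodromy_ice {n : ℕ} (w : Fin n → Weights) {i j : Fin 2} {s t : Config n}
    (h : monodromy w i j s t ≠ 0) : (i : ℕ) + downCount s = j + downCount t := by
  induction n generalizing i j with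
  | zero =>
    rw [monodromy_zero] at h
    have : i = j := by simpa using h
    simp [this, downCount]
  | succ n ih =>
    rw [monodromy_snoc] at h
    obtain ⟨l, -, hl⟩ := Finset.exists_ne_zero_of_sum_ne_zero h
    have h1 := rMatrix_ice _ (left_ne_zero_of_mul hl)
    have h2 := ih _ (right_ne_zero_of_mul hl)
    rw [downCount_succ s, downCount_succ t]
    lia

/-! ### Continuity of scalar products in the weights -/

/-- The entries are polynomials in the weights. Both limiting arguments of the proof rest on this.
-/
theorem continuousAt_monodromy {X : Type*} [TopologicalSpace X] {a : X} {n : ℕ}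
    {w : X → Fin n → Weights}
    (h : ∀ k, ContinuousAt (fun x => (w x k).bPlus) a ∧ ContinuousAt (fun x => (w x k).bMinus) a ∧
      ContinuousAt (fun x => (w x k).cPlus) a ∧ ContinuousAt (fun x => (w x k).cMinus) a ∧
      ContinuousAt (fun x => (w x k).aMinus) a) (i j : Fin 2) (s t : Config n) :
    ContinuousAt (fun x => monodromy (w x) i j s t) a := by
  induction n generalizing i j with
  | zero => simpa only [monodromy_zero] using continuousAt_const
  | succ n ih =>
    simp only [monodromy_snoc]
    refine tendsto_finsetSum _ fun l _ => ContinuousAt.mul ?_ (ih (fun k => h _) _ _ _ _)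
    simp only [rMatrix_eq]
    obtain ⟨h1, h2, h3, h4, h5⟩ := h (Fin.last n)
    split_ifs
    exacts [continuousAt_const, h1, h3, h4, h2, h5, continuousAt_const]

theorem scalarProduct_eq_sum {L M : ℕ} (wB wC : Fin M → Fin L → Weights) :
    scalarProduct wB wC = ∑ t, (List.ofFn fun m => opB (wB m)).prod (fun _ => 1) t *
      (List.ofFn fun m => opC (wC m)).reverse.prod t (fun _ => 1) := by
  simp [scalarProduct, refState, Matrix.mul_apply]

theorem continuousAt_scalarProduct {X : Type*} [TopologicalSpace X] {a : X} {L M : ℕ}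
    {wB wC : X → Fin M → Fin L → Weights}
    (hB : ∀ m k, ContinuousAt (fun x => (wB x m k).bPlus) a ∧
      ContinuousAt (fun x => (wB x m k).bMinus) a ∧
      ContinuousAt (fun x => (wB x m k).cPlus) a ∧ ContinuousAt (fun x => (wB x m k).cMinus) a ∧
      ContinuousAt (fun x => (wB x m k).aMinus) a)
    (hC : ∀ m k, ContinuousAt (fun x => (wC x m k).bPlus) a ∧
      ContinuousAt (fun x => (wC x m k).bMinus) a ∧
      ContinuousAt (fun x => (wC x m k).cPlus) a ∧ ContinuousAt (fun x => (wC x m k).cMinus) a ∧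
      ContinuousAt (fun x => (wC x m k).aMinus) a) :
    ContinuousAt (fun x => scalarProduct (wB x) (wC x)) a := by
  simp only [scalarProduct_eq_sum]
  refine tendsto_finsetSum _ fun t _ => ContinuousAt.mul ?_ ?_
  · have : ContinuousAt (fun x => (List.ofFn fun m => opB (wB x m)).prod) a := by
      clear hC
      induction M with
      | zero => simpa using continuousAt_const
      | succ M ih =>
        simp only [List.ofFn_succ, List.prod_cons]
        refine ContinuousAt.mul ?_ (ih (wB := fun x m => wB x m.succ) (wC := fun x m => wC x m.succ)
          fun m => hB _)
        exact continuousAt_pi.2 fun s => continuousAt_pi.2 fun t =>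
          continuousAt_monodromy (hB 0) _ _ _ _
    exact continuousAt_pi.1 (continuousAt_pi.1 this _) _
  · have : ContinuousAt (fun x => (List.ofFn fun m => opC (wC x m)).reverse.prod) a := by
      clear hB
      induction M with
      | zero => simpa using continuousAt_const
      | succ M ih =>
        simp only [List.ofFn_succ, List.reverse_cons, List.prod_append, List.prod_singleton]
        refine ContinuousAt.mul (ih (wB := fun x m => wB x m.succ) (wC := fun x m => wC x m.succ)
          fun m => hC _) ?_
        exact continuousAt_pi.2 fun s => continuousAt_pi.2 fun t =>
          continuousAt_monodromy (hC 0) _ _ _ _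
    exact continuousAt_pi.1 (continuousAt_pi.1 this _) _

/-! ### Removing the electric fields -/

/-- The diagonal gauge transformation that moves the quantum fields `β` through the sites. -/
def gauge : {n : ℕ} → (Fin n → ℂ) → Config n → ℂ
  | 0, _, _ => 1
  | n + 1, β, s => gauge (β ∘ Fin.castSucc) (s ∘ Fin.castSucc) *
      β (Fin.last n) ^ (2 * downCount (s ∘ Fin.castSucc) + (s (Fin.last n) : ℕ))

theorem gauge_ne_zero {n : ℕ} {β : Fin n → ℂ} (hβ : ∀ k, β k ≠ 0) (s : Config n) :
    gauge β s ≠ 0 := by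
  induction n with
  | zero => exact one_ne_zero
  | succ n ih => exact mul_ne_zero (ih (fun k => hβ _) _) (pow_ne_zero _ (hβ _))

/-- `v` is obtained from `w` by switching on the electric fields `α²` and `β²`. -/
structure IsTwist (α β : ℂ) (v w : Weights) : Prop where
  bPlus : v.bPlus = α ^ 2 * w.bPlus
  bMinus : v.bMinus = β ^ 2 * w.bMinus
  cPlus : v.cPlus = α * β * w.cPlus
  cMinus : v.cMinus = α * β * w.cMinus
  aMinus : v.aMinus = α ^ 2 * β ^ 2 * w.aMinus

theorem IsTwist.rMatrix {α β : ℂ} {v w : Weights} (h : IsTwist α β v w) (i p j q : Fin 2) :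
    rMatrix v (i, p) (j, q) =
      α ^ ((p : ℕ) + q) * β ^ ((i : ℕ) + j) * rMatrix w (i, p) (j, q) := by
  obtain ⟨h1, h2, h3, h4, h5⟩ := h
  fin_cases i <;> fin_cases p <;> fin_cases j <;> fin_cases q <;> simp [rMatrix_eq, *]

/-- The last site contributes `β ^ (i + l)`, where `i` and `l` are the auxiliary states on its two
sides. The ice rules for this site and for the remaining chain express `i + l` through `j` and the
states `s`, `t`, which gives a conjugation by `gauge` and the factor with exponent `j`. -/
theorem gauge_mul_monodromy {n : ℕ} {α : ℂ} {β : Fin n → ℂ} {v w : Fin n → Weights}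
    (h : ∀ k, IsTwist α (β k) (v k) (w k)) (i j : Fin 2) (s t : Config n) :
    gauge β s * monodromy v i j s t =
      α ^ (downCount s + downCount t) * (∏ k, β k ^ 2) ^ (j : ℕ) * monodromy w i j s t *
        gauge β t := by
  induction n generalizing i j with
  | zero => simp [monodromy_zero, gauge, downCount]
  | succ n ih =>
    simp only [monodromy_snoc, Finset.mul_sum, Finset.sum_mul]
    refine Finset.sum_congr rfl fun l _ => ?_
    by_cases h1 : SixVertex.rMatrix (w (Fin.last n)) (i, s (Fin.last n)) (l, t (Fin.last n)) = 0
    · simp [(h _).rMatrix, h1]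
    by_cases h2 : monodromy (w ∘ Fin.castSucc) l j (s ∘ Fin.castSucc) (t ∘ Fin.castSucc) = 0
    · have := ih (β := β ∘ Fin.castSucc) (v := v ∘ Fin.castSucc)
        (w := w ∘ Fin.castSucc) (fun k => h k.castSucc) l j (s ∘ Fin.castSucc)
        (t ∘ Fin.castSucc)
      rw [h2] at this ⊢
      simp only [gauge]
      linear_combination this * β (Fin.last n) ^
        (2 * downCount (s ∘ Fin.castSucc) + (s (Fin.last n) : ℕ)) *
        SixVertex.rMatrix (v (Fin.last n)) (i, s (Fin.last n)) (l, t (Fin.last n))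
    have e1 := rMatrix_ice _ h1
    have e2 := monodromy_ice _ h2
    have := ih (β := β ∘ Fin.castSucc) (v := v ∘ Fin.castSucc)
        (w := w ∘ Fin.castSucc) (fun k => h k.castSucc) l j (s ∘ Fin.castSucc)
        (t ∘ Fin.castSucc)
    simp only [gauge, (h _).rMatrix, downCount_succ, Fin.prod_univ_castSucc]
    have e3 : 2 * downCount (s ∘ Fin.castSucc) + (s (Fin.last n) : ℕ) + (i + l) =
        2 * j + (2 * downCount (t ∘ Fin.castSucc) + t (Fin.last n)) := by lia
    have e4 : β (Fin.last n) ^ (2 * downCount (s ∘ Fin.castSucc) + (s (Fin.last n) : ℕ)) *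
        β (Fin.last n) ^ ((i : ℕ) + l) = β (Fin.last n) ^ (2 * (j : ℕ)) *
          β (Fin.last n) ^ (2 * downCount (t ∘ Fin.castSucc) + (t (Fin.last n) : ℕ)) := by
      rw [← pow_add, ← pow_add, e3]
    simp only [Function.comp_def] at this e4 ⊢
    calc _ = (gauge (fun k => β k.castSucc) (fun k => s k.castSucc) *
            monodromy (fun k => v k.castSucc) l j (fun k => s k.castSucc) fun k => t k.castSucc) *
          (β (Fin.last n) ^ (2 * downCount (fun k => s k.castSucc) + (s (Fin.last n) : ℕ)) *
            β (Fin.last n) ^ ((i : ℕ) + l)) * (α ^ ((s (Fin.last n) : ℕ) + t (Fin.last n)) *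
          SixVertex.rMatrix (w (Fin.last n)) (i, s (Fin.last n)) (l, t (Fin.last n))) := by ring
      _ = _ := by
        rw [this, e4]
        ring

/-- The `m`-th operator, counted from `0`, lowers the number of `e₂` from `L - m` to `L - m - 1`;
the sum of the two counts is the exponent of `α m`. The second conjunct carries this count through
the induction. -/
theorem gauge_mul_prod_opC {L M : ℕ} {α : Fin M → ℂ} {β : Fin L → ℂ}
    {v w : Fin M → Fin L → Weights} (hα : ∀ m, α m ≠ 0)
    (h : ∀ m k, IsTwist (α m) (β k) (v m k) (w m k)) (s : Config L) :
    gauge β s * (List.ofFn fun m => opC (v m)).reverse.prod s (fun _ => 1) =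
        (∏ m : Fin M, α m ^ (2 * (L : ℤ) - 1 - 2 * (m : ℤ))) *
          (List.ofFn fun m => opC (w m)).reverse.prod s (fun _ => 1) * gauge β (fun _ => 1) ∧
      ((List.ofFn fun m => opC (w m)).reverse.prod s (fun _ => 1) ≠ 0 →
        downCount s + M = L) := by
  induction M generalizing s with
  | zero =>
    by_cases hs : s = fun _ => 1
    · subst hs; simp [downCount]
    · simp [hs]
  | succ M ih =>
    have ih' := fun s => ih (α := α ∘ Fin.castSucc) (v := v ∘ Fin.castSucc)
      (w := w ∘ Fin.castSucc) (fun m => hα _) (fun m k => h _ k) s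
    simp only [Function.comp_def] at ih'
    simp only [List.ofFn_succ', List.concat_eq_append, List.reverse_append, List.reverse_singleton,
      List.singleton_append, List.prod_cons, Matrix.mul_apply]
    constructor
    · rw [Finset.mul_sum, Finset.mul_sum, Finset.sum_mul]
      refine Finset.sum_congr rfl fun t _ => ?_
      have key := gauge_mul_monodromy (h (Fin.last M)) 1 0 s t
      by_cases h1 : opC (w (Fin.last M)) s t = 0
      · rw [opC] at h1
        rw [h1] at key
        rw [opC, opC, h1, ← mul_assoc, key]
        simp
      by_cases h2 : (List.ofFn fun m => opC (w (Fin.castSucc m))).reverse.prod t (fun _ => 1) = 0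
      · have e := (ih' t).1
        rw [h2] at e ⊢
        rw [← mul_assoc, opC, key, Fin.val_zero, pow_zero]
        linear_combination α (Fin.last M) ^ (downCount s + downCount t) *
          monodromy (w (Fin.last M)) 1 0 s t * e
      · have e1 := (ih' t).2 h2
        have e2 := monodromy_ice _ h1
        have e3 : (2 * (L : ℤ) - 1 - 2 * (M : ℤ)) = (downCount s + downCount t : ℕ) := by
          simp at e2; lia
        rw [← mul_assoc, opC, key, mul_assoc, (ih' t).1, Fin.prod_univ_castSucc, Fin.val_last, e3,
          zpow_natCast]
        simp only [opC, Fin.val_castSucc]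
        simp only [Fin.val_zero, pow_zero]
        ring
    · intro hne
      obtain ⟨t, -, ht⟩ := Finset.exists_ne_zero_of_sum_ne_zero hne
      have e1 := (ih' t).2 (right_ne_zero_of_mul ht)
      have e2 := monodromy_ice _ (left_ne_zero_of_mul ht)
      simp at e2
      lia

theorem gauge_mul_prod_opB {L M : ℕ} {α : Fin M → ℂ} {β : Fin L → ℂ}
    {v w : Fin M → Fin L → Weights} (hα : ∀ m, α m ≠ 0)
    (h : ∀ m k, IsTwist (α m) (β k) (v m k) (w m k)) (t : Config L) :
    gauge β (fun _ => 1) * (List.ofFn fun m => opB (v m)).prod (fun _ => 1) t =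
        (∏ k, β k ^ 2) ^ M * (∏ m : Fin M, α m ^ (2 * (L : ℤ) - 1 - 2 * (m : ℤ))) *
          (List.ofFn fun m => opB (w m)).prod (fun _ => 1) t * gauge β t ∧
      ((List.ofFn fun m => opB (w m)).prod (fun _ => 1) t ≠ 0 → downCount t + M = L) := by
  induction M generalizing t with
  | zero =>
    by_cases ht : t = fun _ => 1
    · subst ht; simp [downCount]
    · simp [Ne.symm ht]
  | succ M ih =>
    have ih' := fun s => ih (α := α ∘ Fin.castSucc) (v := v ∘ Fin.castSucc)
      (w := w ∘ Fin.castSucc) (fun m => hα _) (fun m k => h _ k) s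
    simp only [Function.comp_def] at ih'
    simp only [List.ofFn_succ', List.concat_eq_append, List.prod_append, List.prod_singleton,
      Matrix.mul_apply]
    constructor
    · rw [Finset.mul_sum, Finset.mul_sum, Finset.sum_mul]
      refine Finset.sum_congr rfl fun s _ => ?_
      have key := gauge_mul_monodromy (h (Fin.last M)) 0 1 s t
      by_cases h2 : (List.ofFn fun m => opB (w (Fin.castSucc m))).prod (fun _ => 1) s = 0
      · have e := (ih' s).1
        rw [h2] at e ⊢
        linear_combination opB (v (Fin.last M)) s t * e
      by_cases h1 : opB (w (Fin.last M)) s t = 0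
      · rw [opB] at h1
        rw [h1] at key
        rw [opB, opB, h1, ← mul_assoc, (ih' s).1, mul_assoc, key]
        simp
      · have e1 := (ih' s).2 h2
        have e2 := monodromy_ice _ h1
        have e3 : (2 * (L : ℤ) - 1 - 2 * (M : ℤ)) = (downCount s + downCount t : ℕ) := by
          simp at e2; lia
        rw [← mul_assoc, (ih' s).1, opB, mul_assoc, key, Fin.prod_univ_castSucc, Fin.val_last, e3,
          zpow_natCast]
        simp only [opB, Fin.val_castSucc, Fin.val_one, pow_one]
        ring
    · intro hne
      obtain ⟨s, -, ht⟩ := Finset.exists_ne_zero_of_sum_ne_zero hne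
      have e1 := (ih' s).2 (left_ne_zero_of_mul ht)
      have e2 := monodromy_ice _ (right_ne_zero_of_mul ht)
      simp at e2
      lia

/-- The gauge factors of the intermediate state cancel between the two halves, and those of the
reference state cancel because they do not vanish. -/
theorem scalarProduct_twist {L M : ℕ} {α γ : Fin M → ℂ} {β : Fin L → ℂ}
    {v w v' w' : Fin M → Fin L → Weights} (hα : ∀ m, α m ≠ 0) (hγ : ∀ m, γ m ≠ 0)
    (hβ : ∀ k, β k ≠ 0) (h : ∀ m k, IsTwist (α m) (β k) (v m k) (w m k))
    (h' : ∀ m k, IsTwist (γ m) (β k) (v' m k) (w' m k)) :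
    scalarProduct v v' = (∏ k, β k ^ 2) ^ M *
      (∏ m : Fin M, (α m * γ m) ^ (2 * (L : ℤ) - 1 - 2 * (m : ℤ))) * scalarProduct w w' := by
  apply mul_left_cancel₀ (gauge_ne_zero hβ fun _ => 1)
  simp only [scalarProduct_eq_sum, Finset.mul_sum, mul_zpow, Finset.prod_mul_distrib]
  refine Finset.sum_congr rfl fun t _ => ?_
  rw [← mul_assoc, (gauge_mul_prod_opB hα h t).1, mul_assoc, (gauge_mul_prod_opC hγ h' t).1]
  ring

/-- The weights `w` with the electric fields `α²` and `β²` switched on. -/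
def twistWeights (α β : ℂ) (w : Weights) : Weights where
  bPlus := α ^ 2 * w.bPlus
  bMinus := β ^ 2 * w.bMinus
  cPlus := α * β * w.cPlus
  cMinus := α * β * w.cMinus
  aMinus := α ^ 2 * β ^ 2 * w.aMinus

theorem fieldWeights_eq_twistWeights {r : ℂ → ℂ} (hr : ∀ u, r u ^ 2 = u) (ρ μ ξ x z : ℂ) :
    fieldWeights r ρ μ ξ x z = twistWeights (r x)⁻¹ (r z) (symWeights r ρ μ ξ) := by
  simp only [fieldWeights, twistWeights, symWeights, inv_pow, hr, Weights.mk.injEq]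
  refine ⟨?_, ?_, ?_, ?_, ?_⟩ <;> ring

theorem fieldScalarProduct_eq {r : ℂ → ℂ} (hr : ∀ u, r u ^ 2 = u) {L M : ℕ}
    (ρ : ℂ) (ξ z : Fin L → ℂ) (μ x ν y : Fin M → ℂ) (hx : ∀ m, x m ≠ 0) (hy : ∀ m, y m ≠ 0) :
    fieldScalarProduct r ρ ξ z μ x ν y =
      (∏ l, z l ^ M) /
          (∏ m : Fin M, (r (x m) * r (y m)) ^ (2 * (L : ℤ) + 1 - 2 * ((m : ℤ) + 1))) *
        symScalarProduct r ρ ξ μ ν := by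
  have hr0 : ∀ u, u ≠ 0 → (r u)⁻¹ ≠ 0 := fun u hu => inv_ne_zero fun h => hu (by rw [← hr u, h]; simp)
  -- Some `z k` may vanish, and then the gauge is not invertible. Shifting `r (z k)` by a small `t ≠
  -- 0` repairs this; `r` itself need not be continuous.
  let F : ℂ → ℂ := fun t => scalarProduct
    (fun m k => twistWeights (r (x m))⁻¹ (r (z k) + t) (symWeights r ρ (μ m) (ξ k)))
    (fun m k => twistWeights (r (y m))⁻¹ (r (z k) + t) (symWeights r ρ (ν m) (ξ k)))
  let G : ℂ → ℂ := fun t => (∏ k, (r (z k) + t) ^ 2) ^ M *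
      (∏ m : Fin M, ((r (x m))⁻¹ * (r (y m))⁻¹) ^ (2 * (L : ℤ) - 1 - 2 * (m : ℤ))) *
        symScalarProduct r ρ ξ μ ν
  have hF : ContinuousAt F 0 := by
    apply continuousAt_scalarProduct <;>
    · intro m k
      simp only [twistWeights]
      refine ⟨?_, ?_, ?_, ?_, ?_⟩ <;> fun_prop
  have hG : ContinuousAt G 0 := by fun_prop
  have hFG : F =ᶠ[nhdsWithin 0 {0}ᶜ] G := by
    have : ∀ᶠ t in nhdsWithin (0 : ℂ) {0}ᶜ, ∀ k, r (z k) + t ≠ 0 := by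
      rw [Filter.eventually_all]
      intro k
      by_cases hk : r (z k) = 0
      · filter_upwards [self_mem_nhdsWithin] with t ht
        simpa [hk] using ht
      · have : ContinuousAt (fun t : ℂ => r (z k) + t) 0 := by fun_prop
        exact (this.eventually_ne (by simpa using hk)).filter_mono nhdsWithin_le_nhds
    filter_upwards [this] with t ht
    exact scalarProduct_twist (fun m => hr0 _ (hx m)) (fun m => hr0 _ (hy m)) ht
      (fun m k => ⟨rfl, rfl, rfl, rfl, rfl⟩) (fun m k => ⟨rfl, rfl, rfl, rfl, rfl⟩)
  have h0 : F 0 = G 0 := tendsto_nhds_unique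
    ((hF.tendsto.mono_left nhdsWithin_le_nhds).congr' hFG) (hG.tendsto.mono_left nhdsWithin_le_nhds)
  simp only [F, G, add_zero, ← fieldWeights_eq_twistWeights hr, hr] at h0
  rw [fieldScalarProduct, h0, div_eq_mul_inv, Finset.prod_pow, ← Finset.prod_inv_distrib]
  congr 2
  refine Finset.prod_congr rfl fun m _ => ?_
  rw [← mul_inv, inv_zpow]
  congr 2
  ring

/-! ### Factorizing basis -/

/-- The symmetric weight `b`, in terms of the square roots `q`, `p`, `s` of `ρ`, `μ`, `ξ`. -/
def bWeight (q p s : ℂ) : ℂ := q * ((p ^ 2 - s ^ 2) / (p ^ 2 * q ^ 2 - s ^ 2))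

/-- The symmetric weight `c`, in terms of the square roots `q`, `p`, `s` of `ρ`, `μ`, `ξ`. -/
def cWeight (q p s : ℂ) : ℂ := (q ^ 2 - 1) * (p * s / (p ^ 2 * q ^ 2 - s ^ 2))

/-- The symmetric weights in terms of the square roots `q`, `p`, `s` of `ρ`, `μ`, `ξ`. -/
def sqrtWeights (q p s : ℂ) : Weights :=
  ⟨bWeight q p s, bWeight q p s, cWeight q p s, cWeight q p s, 1⟩

/-- In terms of the square roots the weights are rational functions, so parameters can be deformed
although `r` is an arbitrary choice. -/
theorem symWeights_eq_sqrtWeights {r : ℂ → ℂ} (hr : ∀ u, r u ^ 2 = u) (ρ μ ξ : ℂ) :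
    symWeights r ρ μ ξ = sqrtWeights (r ρ) (r μ) (r ξ) := by
  simp [symWeights, sqrtWeights, bWeight, cWeight, hr]

theorem bWeight_ne_zero {q p s : ℂ} (hq : q ≠ 0) (h : p ^ 2 ≠ s ^ 2)
    (h' : p ^ 2 * q ^ 2 ≠ s ^ 2) : bWeight q p s ≠ 0 :=
  mul_ne_zero hq (div_ne_zero (sub_ne_zero.2 h) (sub_ne_zero.2 h'))

/-! ### Rational identities between the weights -/

section Scalar

variable {q l z k m : ℂ}

theorem cWeight_mul_bWeight_mul_bWeight (hlz : l ^ 2 * q ^ 2 ≠ z ^ 2) (hlk : l ^ 2 * q ^ 2 ≠ k ^ 2)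
    (hzk : z ^ 2 * q ^ 2 ≠ k ^ 2) (hkz : k ^ 2 * q ^ 2 ≠ z ^ 2) :
    cWeight q l k * bWeight q k z * bWeight q z k =
      cWeight q l k * bWeight q l z * bWeight q z k +
        cWeight q l z * cWeight q z k * bWeight q l k * bWeight q k z := by
  have h1 := sub_ne_zero.2 hlz
  have h2 := sub_ne_zero.2 hlk
  have h3 := sub_ne_zero.2 hzk
  have h4 := sub_ne_zero.2 hkz
  simp only [cWeight, bWeight]
  -- The denominators are atoms for `field_simp` and are expanded only for the final `ring`.
  generalize e1 : l ^ 2 * q ^ 2 - z ^ 2 = d1 at *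
  generalize e2 : l ^ 2 * q ^ 2 - k ^ 2 = d2 at *
  generalize e3 : z ^ 2 * q ^ 2 - k ^ 2 = d3 at *
  generalize e4 : k ^ 2 * q ^ 2 - z ^ 2 = d4 at *
  field_simp
  subst e1 e2 e3 e4
  ring

theorem bWeight_mul_cWeight_mul_cWeight (hlz : l ^ 2 * q ^ 2 ≠ z ^ 2) (hlk : l ^ 2 * q ^ 2 ≠ k ^ 2)
    (hzk : z ^ 2 * q ^ 2 ≠ k ^ 2) :
    bWeight q z k * cWeight q l z * cWeight q l k + cWeight q z k * bWeight q l z =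
      bWeight q l k * cWeight q z k := by
  have h1 := sub_ne_zero.2 hlz
  have h2 := sub_ne_zero.2 hlk
  have h3 := sub_ne_zero.2 hzk
  simp only [cWeight, bWeight]
  generalize e1 : l ^ 2 * q ^ 2 - z ^ 2 = d1 at *
  generalize e2 : l ^ 2 * q ^ 2 - k ^ 2 = d2 at *
  generalize e3 : z ^ 2 * q ^ 2 - k ^ 2 = d3 at *
  field_simp
  subst e1 e2 e3
  ring

theorem bWeight_mul_bWeight_mul_cWeight (hlz : l ^ 2 * q ^ 2 ≠ z ^ 2) (hlk : l ^ 2 * q ^ 2 ≠ k ^ 2)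
    (hzk : z ^ 2 * q ^ 2 ≠ k ^ 2) :
    bWeight q z k * bWeight q l z * cWeight q l k + cWeight q z k * cWeight q l z =
      cWeight q l k := by
  have h1 := sub_ne_zero.2 hlz
  have h2 := sub_ne_zero.2 hlk
  have h3 := sub_ne_zero.2 hzk
  simp only [cWeight, bWeight]
  generalize e1 : l ^ 2 * q ^ 2 - z ^ 2 = d1 at *
  generalize e2 : l ^ 2 * q ^ 2 - k ^ 2 = d2 at *
  generalize e3 : z ^ 2 * q ^ 2 - k ^ 2 = d3 at *
  field_simp
  subst e1 e2 e3
  ring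

/-- The two-site content of the commutation of `B(z)` with `B(l)`: sites `k` and `m` are removed in
either order, and both orders are needed in the sum. -/
theorem cWeight_exchange (hlk : l ^ 2 * q ^ 2 ≠ k ^ 2) (hlm : l ^ 2 * q ^ 2 ≠ m ^ 2)
    (hzk : z ^ 2 * q ^ 2 ≠ k ^ 2) (hzm : z ^ 2 * q ^ 2 ≠ m ^ 2)
    (hkm : k ^ 2 * q ^ 2 ≠ m ^ 2) (hmk : m ^ 2 * q ^ 2 ≠ k ^ 2) :
    cWeight q z k * bWeight q z m * cWeight q l m * bWeight q m k +
        cWeight q z m * bWeight q z k * cWeight q l k * bWeight q k m =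
      cWeight q l k * bWeight q l m * cWeight q z m * bWeight q m k +
        cWeight q l m * bWeight q l k * cWeight q z k * bWeight q k m := by
  have h1 := sub_ne_zero.2 hlk
  have h2 := sub_ne_zero.2 hlm
  have h3 := sub_ne_zero.2 hzk
  have h4 := sub_ne_zero.2 hzm
  have h5 := sub_ne_zero.2 hkm
  have h6 := sub_ne_zero.2 hmk
  simp only [cWeight, bWeight]
  generalize e1 : l ^ 2 * q ^ 2 - k ^ 2 = d1 at *
  generalize e2 : l ^ 2 * q ^ 2 - m ^ 2 = d2 at *
  generalize e3 : z ^ 2 * q ^ 2 - k ^ 2 = d3 at *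
  generalize e4 : z ^ 2 * q ^ 2 - m ^ 2 = d4 at *
  generalize e5 : k ^ 2 * q ^ 2 - m ^ 2 = d5 at *
  generalize e6 : m ^ 2 * q ^ 2 - k ^ 2 = d6 at *
  field_simp
  subst e1 e2 e3 e4 e5 e6
  ring

end Scalar

/-- The eigenvalue of the operator `D` on the factorizing basis vector labelled by the set
of sites `k` with `S k = 0`. -/
def eigD (q : ℂ) {n : ℕ} (s : Fin n → ℂ) (S : Config n) (p : ℂ) : ℂ :=
  ∏ k, if S k = 0 then bWeight q p (s k) else 1

/-- The matrix element of the operator `B` that removes the site `k` from the set `S`. -/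
def coeffB (q : ℂ) {n : ℕ} (s : Fin n → ℂ) (S : Config n) (p : ℂ) (k : Fin n) : ℂ :=
  cWeight q p (s k) * eigD q s (Function.update S k 1) p /
    eigD q s (Function.update S k 1) (s k)

/-- The components of the factorizing basis vector labelled by `S`. -/
def factorVec (q : ℂ) : {n : ℕ} → (Fin n → ℂ) → Config n → Config n → ℂ
  | 0, _, _, _ => 1
  | n + 1, s, S, t =>
    if S (Fin.last n) = 0 then
      if t (Fin.last n) = 0 then
        factorVec q (s ∘ Fin.castSucc) (S ∘ Fin.castSucc) (t ∘ Fin.castSucc) else 0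
    else if t (Fin.last n) = 0 then
      ∑ k, if (S ∘ Fin.castSucc) k = 0 then
        coeffB q (s ∘ Fin.castSucc) (S ∘ Fin.castSucc) (s (Fin.last n)) k *
          factorVec q (s ∘ Fin.castSucc) (Function.update (S ∘ Fin.castSucc) k 1)
            (t ∘ Fin.castSucc) else 0
    else eigD q (s ∘ Fin.castSucc) (S ∘ Fin.castSucc) (s (Fin.last n)) *
      factorVec q (s ∘ Fin.castSucc) (S ∘ Fin.castSucc) (t ∘ Fin.castSucc)

theorem eigD_succ (q : ℂ) {n : ℕ} (s : Fin (n + 1) → ℂ) (S : Config (n + 1)) (p : ℂ) :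
    eigD q s S p = eigD q (s ∘ Fin.castSucc) (S ∘ Fin.castSucc) p *
      if S (Fin.last n) = 0 then bWeight q p (s (Fin.last n)) else 1 := by
  simp [eigD, Fin.prod_univ_castSucc]

theorem eigD_update (q : ℂ) {n : ℕ} (s : Fin n → ℂ) {S : Config n} {k : Fin n} (hk : S k = 0)
    (p : ℂ) : eigD q s S p = eigD q s (Function.update S k 1) p * bWeight q p (s k) := by
  rw [eigD, eigD, ← Finset.mul_prod_erase _ _ (Finset.mem_univ k),
    ← Finset.mul_prod_erase _ _ (Finset.mem_univ k)]
  rw [Finset.prod_congr rfl (g := fun j => if Function.update S k 1 j = 0 then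
    bWeight q p (s j) else 1)]
  · simp [hk, mul_comm]
  · intro j hj
    rw [Function.update_of_ne (Finset.ne_of_mem_erase hj)]

theorem eigD_ne_zero {q : ℂ} (hq : q ≠ 0) {n : ℕ} {s : Fin n → ℂ} {S : Config n} {p : ℂ}
    (h : ∀ k, S k = 0 → p ^ 2 ≠ s k ^ 2) (h' : ∀ k, p ^ 2 * q ^ 2 ≠ s k ^ 2) :
    eigD q s S p ≠ 0 := by
  refine Finset.prod_ne_zero_iff.2 fun k _ => ?_
  split_ifs with hk
  · exact bWeight_ne_zero hq (h k hk) (h' k)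
  · exact one_ne_zero

/-- The inhomogeneities (given by square roots) are in general position. -/
structure Generic (q : ℂ) {n : ℕ} (s : Fin n → ℂ) : Prop where
  ne_zero : q ≠ 0
  sq_ne : ∀ j k, j ≠ k → s j ^ 2 ≠ s k ^ 2
  mul_ne : ∀ j k, s j ^ 2 * q ^ 2 ≠ s k ^ 2

theorem Generic.castSucc {q : ℂ} {n : ℕ} {s : Fin (n + 1) → ℂ} (h : Generic q s) :
    Generic q (s ∘ Fin.castSucc) :=
  ⟨h.1, fun _ _ hjk => h.2 _ _ (by simpa using hjk), fun _ _ => h.3 _ _⟩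

theorem Generic.eigD_update_ne_zero {q : ℂ} {n : ℕ} {s : Fin n → ℂ} (h : Generic q s)
    (S : Config n) (k : Fin n) : eigD q s (Function.update S k 1) (s k) ≠ 0 := by
  refine eigD_ne_zero h.1 (fun j hj => ?_) (h.3 k)
  rcases eq_or_ne j k with rfl | hjk
  · simp at hj
  · exact h.2 _ _ hjk.symm

theorem update_comp_castSucc {n : ℕ} (S : Config (n + 1)) (k : Fin n) (a : Fin 2) :
    Function.update S k.castSucc a ∘ Fin.castSucc = Function.update (S ∘ Fin.castSucc) k a :=
  Function.update_comp_eq_of_injective _ (Fin.castSucc_injective n) _ _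

theorem update_last_comp_castSucc {n : ℕ} (S : Config (n + 1)) (a : Fin 2) :
    Function.update S (Fin.last n) a ∘ Fin.castSucc = S ∘ Fin.castSucc := by
  funext k
  simp [(Fin.castSucc_lt_last k).ne]

theorem sum_config_succ {n : ℕ} (f : Config (n + 1) → ℂ) :
    ∑ t, f t = ∑ t : Config n, f (Fin.snoc t 0) + ∑ t : Config n, f (Fin.snoc t 1) := by
  rw [← (Fin.snocEquiv (fun _ : Fin (n + 1) => Fin 2)).sum_comp, Fintype.sum_prod_type,
    Fin.sum_univ_two]
  rfl

theorem snoc_comp_castSucc {n : ℕ} (t : Config n) (a : Fin 2) :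
    (Fin.snoc t a : Config (n + 1)) ∘ Fin.castSucc = t := by
  funext k
  simp

/-! ### Commutation of the site-removing operators -/

section Exchange

variable {q : ℂ} {n : ℕ} {s : Fin n → ℂ}

theorem sum_coeffB_exchange (h : Generic q s) (S : Config n) {p p' : ℂ}
    (hp : ∀ k, p ^ 2 * q ^ 2 ≠ s k ^ 2) (hp' : ∀ k, p' ^ 2 * q ^ 2 ≠ s k ^ 2)
    (v : Config n → ℂ) :
    (∑ k, if S k = 0 then coeffB q s S p k * ∑ m, if Function.update S k 1 m = 0 then
        coeffB q s (Function.update S k 1) p' m *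
          v (Function.update (Function.update S k 1) m 1) else 0 else 0) =
      ∑ k, if S k = 0 then coeffB q s S p' k * ∑ m, if Function.update S k 1 m = 0 then
        coeffB q s (Function.update S k 1) p m *
          v (Function.update (Function.update S k 1) m 1) else 0 else 0 := by
  have key (k m : Fin n) (hk : S k = 0) (hm : S m = 0) (hkm : k ≠ m) :
      coeffB q s S p k * coeffB q s (Function.update S k 1) p' m +
        coeffB q s S p m * coeffB q s (Function.update S m 1) p' k =
      coeffB q s S p' k * coeffB q s (Function.update S k 1) p m +
        coeffB q s S p' m * coeffB q s (Function.update S m 1) p k := by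
    have hc : Function.update (Function.update S m 1) k 1 =
      Function.update (Function.update S k 1) m 1 := Function.update_comm hkm.symm _ _ _
    have hm' : Function.update S k 1 m = 0 := by rwa [Function.update_of_ne hkm.symm]
    have hk' : Function.update S m 1 k = 0 := by rwa [Function.update_of_ne hkm]
    have e1 := cWeight_exchange (hp' k) (hp' m) (hp k) (hp m) (h.3 k m) (h.3 m k)
    have n1 := bWeight_ne_zero h.1 (h.2 k m hkm) (h.3 k m)
    have n2 := bWeight_ne_zero h.1 (h.2 m k hkm.symm) (h.3 m k)
    have n3 := h.eigD_update_ne_zero (Function.update S k 1) m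
    have n4 := h.eigD_update_ne_zero (Function.update S m 1) k
    simp only [coeffB, eigD_update q s hm', eigD_update q s hk']
    simp only [hc] at n4 ⊢
    field_simp
    linear_combination (eigD q s (Function.update (Function.update S k 1) m 1) p *
      eigD q s (Function.update (Function.update S k 1) m 1) p') * e1
  have expand (x y : ℂ) : (∑ k, if S k = 0 then coeffB q s S x k * ∑ m,
      if Function.update S k 1 m = 0 then coeffB q s (Function.update S k 1) y m *
          v (Function.update (Function.update S k 1) m 1) else 0 else 0) =
      ∑ k, ∑ m, if S k = 0 ∧ S m = 0 ∧ k ≠ m then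
        coeffB q s S x k * coeffB q s (Function.update S k 1) y m *
          v (Function.update (Function.update S k 1) m 1) else 0 := by
    refine Finset.sum_congr rfl fun k _ => ?_
    by_cases hk : S k = 0
    · rw [if_pos hk, Finset.mul_sum]
      refine Finset.sum_congr rfl fun m _ => ?_
      rcases eq_or_ne k m with rfl | hkm
      · simp
      · simp only [Function.update_of_ne hkm.symm]
        split_ifs <;> simp_all [mul_assoc]
    · simp [hk]
  rw [expand, expand]
  -- Single terms do not match, only the sum of the terms `(k, m)` and `(m, k)`. Doubling the sum
  -- and swapping the indices in one copy pairs them.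
  apply mul_left_cancel₀ (two_ne_zero (α := ℂ))
  rw [two_mul, two_mul]
  conv_lhs => arg 2; rw [Finset.sum_comm]
  conv_rhs => arg 2; rw [Finset.sum_comm]
  simp only [← Finset.sum_add_distrib]
  refine Finset.sum_congr rfl fun k _ => Finset.sum_congr rfl fun m _ => ?_
  by_cases hkm : S k = 0 ∧ S m = 0 ∧ k ≠ m
  · obtain ⟨hk, hm, hne⟩ := hkm
    rw [if_pos ⟨hk, hm, hne⟩, if_pos ⟨hm, hk, hne.symm⟩, if_pos ⟨hk, hm, hne⟩,
      if_pos ⟨hm, hk, hne.symm⟩, Function.update_comm hne.symm]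
    linear_combination v (Function.update (Function.update S k 1) m 1) * key k m hk hm hne
  · have : ¬ (S m = 0 ∧ S k = 0 ∧ m ≠ k) := fun h => hkm ⟨h.2.1, h.1, h.2.2.symm⟩
    simp [hkm, this]

end Exchange

/-! ### Action of `D` and `B` on the factorizing basis -/

theorem sum_monodromy_succ_mul {n : ℕ} (w : Fin (n + 1) → Weights) (i j : Fin 2)
    (u : Config (n + 1)) (f : Config (n + 1) → ℂ) :
    ∑ t, monodromy w i j u t * f t =
      ∑ a, ∑ l, rMatrix (w (Fin.last n)) (i, u (Fin.last n)) (l, a) *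
        ∑ t, monodromy (w ∘ Fin.castSucc) l j (u ∘ Fin.castSucc) t * f (Fin.snoc t a) := by
  rw [sum_config_succ]
  simp only [monodromy_snoc, Fin.snoc_last, snoc_comp_castSucc, Fin.sum_univ_two, Finset.mul_sum,
    Finset.sum_add_distrib, add_mul, mul_assoc]
  ring

theorem sum_mul_const_mul {ι : Type*} [Fintype ι] (a f : ι → ℂ) (c : ℂ) :
    ∑ t, a t * (c * f t) = c * ∑ t, a t * f t := by
  rw [Finset.mul_sum]
  exact Finset.sum_congr rfl fun t _ => by ring

theorem sum_mul_sum_ite {ι κ : Type*} [Fintype ι] [Fintype κ] (P : κ → Prop) [DecidablePred P]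
    (a : ι → ℂ) (c : κ → ℂ) (g : κ → ι → ℂ) :
    (∑ t, a t * ∑ k, if P k then c k * g k t else 0) =
      ∑ k, if P k then c k * ∑ t, a t * g k t else 0 := by
  simp only [Finset.mul_sum]
  rw [Finset.sum_comm]
  refine Finset.sum_congr rfl fun k _ => ?_
  split_ifs
  · exact Finset.sum_congr rfl fun t _ => by ring
  · simp

/-- Peeling off the last site keeps the column index `1`, so `D` and `B` form a closed system in the
induction and `A`, `C` never enter. Coefficients of each shorter basis vector are then compared by
the scalar identities. -/
theorem monodromy_factorVec {q : ℂ} {n : ℕ} {s : Fin n → ℂ} (h : Generic q s) (S : Config n)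
    {p : ℂ} (hp : ∀ k, p ^ 2 * q ^ 2 ≠ s k ^ 2) (u : Config n) :
    ∑ t, monodromy (fun k => sqrtWeights q p (s k)) 1 1 u t * factorVec q s S t =
        eigD q s S p * factorVec q s S u ∧
      ∑ t, monodromy (fun k => sqrtWeights q p (s k)) 0 1 u t * factorVec q s S t =
        ∑ k, if S k = 0 then coeffB q s S p k * factorVec q s (Function.update S k 1) u
          else 0 := by
  induction n with
  | zero => simp [monodromy_zero, factorVec, eigD]
  | succ n ih =>
    have ihD := fun T v => (ih h.castSucc T (fun k => hp k.castSucc) v).1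
    have ihB := fun T v => (ih h.castSucc T (fun k => hp k.castSucc) v).2
    clear ih
    have hz : ∀ k, s (Fin.last n) ^ 2 * q ^ 2 ≠ (s ∘ Fin.castSucc) k ^ 2 := fun k => h.3 _ _
    have hpz := hp (Fin.last n)
    have hpc : ∀ k, p ^ 2 * q ^ 2 ≠ (s ∘ Fin.castSucc) k ^ 2 := fun k => hp _
    have hzk : ∀ k, s (Fin.last n) ^ 2 ≠ (s ∘ Fin.castSucc) k ^ 2 :=
      fun k => h.2 _ _ (Fin.castSucc_lt_last k).ne'
    have hkz' : ∀ k, (s ∘ Fin.castSucc) k ^ 2 ≠ s (Fin.last n) ^ 2 := fun k => (hzk k).symm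
    have hkz : ∀ k, (s ∘ Fin.castSucc) k ^ 2 * q ^ 2 ≠ s (Fin.last n) ^ 2 := fun k => h.3 _ _
    have hex := fun T v => sum_coeffB_exchange h.castSucc T hpc hz v
    have hne := fun T k => h.castSucc.eigD_update_ne_zero T k
    have hnz : ∀ T, eigD q (s ∘ Fin.castSucc) T (s (Fin.last n)) ≠ 0 :=
      fun T => eigD_ne_zero h.1 (fun k _ => hzk k) hz
    have ew : (fun k => sqrtWeights q p (s k)) ∘ Fin.castSucc =
      fun k => sqrtWeights q p ((s ∘ Fin.castSucc) k) := rfl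
    have hq := h.1
    simp only [sum_monodromy_succ_mul, ew, factorVec, Fin.snoc_last, snoc_comp_castSucc, eigD_succ,
      Fin.sum_univ_castSucc (n := n), update_comp_castSucc, update_last_comp_castSucc]
    have coeffB_castSucc (k : Fin n) : coeffB q s S p k.castSucc =
        coeffB q (s ∘ Fin.castSucc) (S ∘ Fin.castSucc) p k * if S (Fin.last n) = 0 then
          bWeight q p (s (Fin.last n)) / bWeight q (s k.castSucc) (s (Fin.last n)) else 1 := by
      simp only [coeffB, eigD_succ, update_comp_castSucc,
        Function.update_of_ne (Fin.castSucc_lt_last k).ne', Function.comp]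
      split_ifs
      · ring
      · ring
    have coeffB_last : coeffB q s S p (Fin.last n) =
        cWeight q p (s (Fin.last n)) * eigD q (s ∘ Fin.castSucc) (S ∘ Fin.castSucc) p /
          eigD q (s ∘ Fin.castSucc) (S ∘ Fin.castSucc) (s (Fin.last n)) := by
      simp [coeffB, eigD_succ, update_last_comp_castSucc]
    simp only [coeffB_castSucc, coeffB_last,
      fun k : Fin n => Function.update_of_ne (Fin.castSucc_lt_last k).ne' (1 : Fin 2) S]
    generalize hx : u (Fin.last n) = x
    generalize hS : S (Fin.last n) = y
    have hk0 : ∀ k : Fin n, s k.castSucc = (s ∘ Fin.castSucc) k := fun _ => rfl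
    have hk1 : ∀ k : Fin n, S k.castSucc = (S ∘ Fin.castSucc) k := fun _ => rfl
    simp only [hk0, hk1]
    clear hk0 hk1 ew coeffB_castSucc coeffB_last
    generalize s (Fin.last n) = z at *
    have h' := h.castSucc
    clear h
    generalize s ∘ Fin.castSucc = s' at *
    generalize S ∘ Fin.castSucc = S' at *
    generalize u ∘ Fin.castSucc = u' at *
    -- The label of the last site is `y`, and `x` is the component at that site.
    fin_cases y
    · simp only [Fin.zero_eta, if_true, mul_zero, Finset.sum_const_zero, Fin.sum_univ_two, one_ne_zero,
        if_false, ihD, ihB, Function.update_self, Fin.isValue]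
      fin_cases x
      · simp [rMatrix_eq, sqrtWeights]
        refine ⟨by ring, ?_⟩
        rw [Finset.mul_sum, ← Finset.sum_add_distrib]
        refine Finset.sum_congr rfl fun k _ => ?_
        split_ifs with hk
        · have e := cWeight_mul_bWeight_mul_bWeight hpz (hpc k) (hz k) (hkz k)
          have n1 := hne S' k
          have n2 := hnz (Function.update S' k 1)
          have n3 := bWeight_ne_zero hq (hzk k) (hz k)
          have n4 := bWeight_ne_zero hq (hkz' k) (hkz k)
          simp only [coeffB, eigD_update q s' hk]
          field_simp
          linear_combination eigD q s' (Function.update S' k 1) p *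
            factorVec q s' (Function.update S' k 1) u' * e
        · simp
      -- Only the removal of the last site contributes; the denominator of its coefficient cancels
      -- the eigenvalue of `D(z)` in the `e₂` component.
      · simp [rMatrix_eq, sqrtWeights]
        have := hnz S'
        field_simp
    · simp only [Fin.mk_one, if_true, Fin.sum_univ_two, one_ne_zero,
        if_false, sum_mul_sum_ite, sum_mul_const_mul, ihD, ihB,
        Function.update_self, Fin.isValue]
      fin_cases x
      · simp [rMatrix_eq, sqrtWeights]
        constructor
        · simp only [Finset.mul_sum, ← Finset.sum_add_distrib]
          refine Finset.sum_congr rfl fun k _ => ?_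
          split_ifs with hk
          · have e := bWeight_mul_cWeight_mul_cWeight hpz (hpc k) (hz k)
            have n1 := hne S' k
            simp only [coeffB, eigD_update q s' hk]
            field_simp
            linear_combination eigD q s' (Function.update S' k 1) p *
              eigD q s' (Function.update S' k 1) z *
              factorVec q s' (Function.update S' k 1) u' * e
          · simp
        -- The `e₁` component is `B(z) ψ`, so the claim is that `B(p)` and `B(z)` commute.
        · exact (hex S' fun T => factorVec q s' T u').symm
      · simp [rMatrix_eq, sqrtWeights]
        refine ⟨by ring, ?_⟩
        simp only [Finset.mul_sum, ← Finset.sum_add_distrib]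
        refine Finset.sum_congr rfl fun k _ => ?_
        split_ifs with hk
        · have e := bWeight_mul_bWeight_mul_cWeight hpz (hpc k) (hz k)
          have n1 := hne S' k
          simp only [coeffB, eigD_update q s' hk]
          field_simp
          linear_combination eigD q s' (Function.update S' k 1) p *
            eigD q s' (Function.update S' k 1) z *
            factorVec q s' (Function.update S' k 1) u' * e
        · simp

/-! ### The Izergin determinant -/

theorem prod_prod_lt_succAbove {n : ℕ} (f : Fin (n + 1) → Fin (n + 1) → ℂ) (k : Fin (n + 1)) :
    (∏ i, ∏ j, if i < j then f i j else 1) =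
      (∏ i, ∏ j, if i < j then f (k.succAbove i) (k.succAbove j) else 1) *
        ∏ i, if k < k.succAbove i then f k (k.succAbove i) else f (k.succAbove i) k := by
  rw [Fin.prod_univ_succAbove _ k]
  simp only [Fin.prod_univ_succAbove _ k, lt_self_iff_false, if_false, one_mul,
    Fin.succAbove_lt_succAbove_iff, Finset.prod_mul_distrib]
  rw [← mul_assoc, mul_comm, ← Finset.prod_mul_distrib]
  congr 1
  refine Finset.prod_congr rfl fun i _ => ?_
  rcases lt_or_gt_of_ne (Fin.succAbove_ne k i) with h | h
  · simp [h, h.not_gt]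
  · simp [h, h.not_gt]

/-- There are `n - k` indices above `k`, and `n - k` has the parity of `n + k`. This sign of the
Vandermonde product cancels the cofactor sign in `izerginRat_snoc`. -/
theorem prod_sign_succAbove {n : ℕ} (k : Fin (n + 1)) :
    (∏ i, if k < k.succAbove i then (-1 : ℂ) else 1) = (-1) ^ (n + (k : ℕ)) := by
  rw [Finset.prod_ite, Finset.prod_const, Finset.prod_const_one, mul_one]
  have h1 : (Finset.univ.filter fun i => k < k.succAbove i).card +
      (Finset.univ.filter fun i : Fin n => (i : ℕ) < k).card = n := by
    have e := Finset.card_filter_add_card_filter_not (s := (Finset.univ : Finset (Fin n)))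
      (fun i => k < k.succAbove i)
    rw [Finset.card_univ, Fintype.card_fin] at e
    convert e using 4 with i
    rw [Fin.lt_succAbove_iff_le_castSucc, not_le, Fin.lt_def, Fin.val_castSucc]
  have h2 : (Finset.univ.filter fun i : Fin n => (i : ℕ) < k).card = k := by
    rw [Fin.card_filter_val_lt]
    lia
  have h3 : n + (k : ℕ) = (Finset.univ.filter fun i => k < k.succAbove i).card + 2 * k := by lia
  rw [h3, pow_add, pow_mul]
  simp

/-- Lagrange interpolation of a polynomial of degree `≤ 2 n` with `n` given zeros. -/
theorem eval_eq_sum_of_roots {n : ℕ} {P : Polynomial ℂ} (hP : P.degree < (2 * n + 1 : ℕ))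
    {x : Fin n → ℂ} {y : Fin (n + 1) → ℂ} (hx : Function.Injective x) (hy : Function.Injective y)
    (hxy : ∀ i j, x i ≠ y j) (h0 : ∀ i, P.eval (x i) = 0) (a : ℂ) :
    P.eval a = ∑ k, P.eval (y k) * (∏ i, (a - y (k.succAbove i)) / (y k - y (k.succAbove i))) *
      ∏ i, (a - x i) / (y k - x i) := by
  -- The interpolant on the `2 n + 1` nodes `y k`, `x i`; the nodes `x i` contribute nothing because
  -- `P` vanishes there.
  let Q : Polynomial ℂ := ∑ k, Polynomial.C (P.eval (y k) *
      (∏ i, (y k - y (k.succAbove i))⁻¹) * ∏ i, (y k - x i)⁻¹) *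
    ((∏ i, (Polynomial.X - Polynomial.C (y (k.succAbove i)))) *
      ∏ i, (Polynomial.X - Polynomial.C (x i)))
  have hQ (b : ℂ) : Q.eval b = ∑ k, P.eval (y k) *
      (∏ i, (b - y (k.succAbove i)) / (y k - y (k.succAbove i))) *
      ∏ i, (b - x i) / (y k - x i) := by
    simp only [Q, Polynomial.eval_finsetSum, Polynomial.eval_mul, Polynomial.eval_prod,
      Polynomial.eval_sub, Polynomial.eval_X, Polynomial.eval_C, div_eq_mul_inv,
      Finset.prod_mul_distrib]
    exact Finset.sum_congr rfl fun k _ => by ring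
  have hdQ : Q.degree < (2 * n + 1 : ℕ) := by
    refine lt_of_le_of_lt (Polynomial.degree_sum_le _ _) ?_
    rw [Finset.sup_lt_iff (WithBot.bot_lt_coe _)]
    intro k _
    rw [← Polynomial.smul_eq_C_mul]
    refine lt_of_le_of_lt (Polynomial.degree_smul_le _ _) ?_
    rw [Polynomial.degree_mul, Polynomial.degree_prod, Polynomial.degree_prod]
    simp only [Polynomial.degree_X_sub_C, Finset.sum_const, Finset.card_univ, Fintype.card_fin]
    norm_cast
    simp
    norm_cast
    lia
  have : P = Q := by
    refine Polynomial.eq_of_degrees_lt_of_eval_index_eq (Finset.univ : Finset (Fin (n + 1) ⊕ Fin n))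
      (v := Sum.elim y x) (Function.Injective.injOn ?_) ?_ ?_ ?_
    · exact hy.sumElim hx fun i j h => hxy j i h.symm
    · simpa [two_mul, add_assoc, add_comm, add_left_comm] using hP
    · simpa [two_mul, add_assoc, add_comm, add_left_comm] using hdQ
    · rintro (k | i) -
      · simp only [Sum.elim_inl]
        rw [hQ, Finset.sum_eq_single k]
        · have e1 : ∏ i, (y k - y (k.succAbove i)) / (y k - y (k.succAbove i)) = 1 :=
            Finset.prod_eq_one fun i _ =>
              div_self (sub_ne_zero.2 fun h => Fin.succAbove_ne k i (hy h).symm)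
          have e2 : ∏ i, (y k - x i) / (y k - x i) = 1 :=
            Finset.prod_eq_one fun i _ => div_self (sub_ne_zero.2 (hxy i k).symm)
          rw [e1, e2, mul_one, mul_one]
        · intro j _ hjk
          obtain ⟨i, rfl⟩ := Fin.exists_succAbove_eq hjk.symm
          rw [Finset.prod_eq_zero (Finset.mem_univ i)]
          · simp
          · simp
        · simp
      · simp only [Sum.elim_inr]
        rw [h0, hQ]
        symm
        refine Finset.sum_eq_zero fun k _ => ?_
        have e : ∏ j, (x i - x j) / (y k - x j) = 0 :=
          Finset.prod_eq_zero (Finset.mem_univ i) (by simp)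
        rw [e, mul_zero]
  rw [← hQ, ← this]

/-- The rational part of the Izergin determinant expression. -/
def izerginRat (ρ : ℂ) {n : ℕ} (x y : Fin n → ℂ) : ℂ :=
  (∏ i, ∏ j, (x i - y j)) / ((∏ i, ∏ j, if i < j then x i - x j else 1) *
      ∏ i, ∏ j, if i < j then y j - y i else 1) *
    (Matrix.of fun i j => (ρ - 1) / ((x i * ρ - y j) * (x i - y j))).det

theorem prod_prod_lt_ne_zero {n : ℕ} {x : Fin n → ℂ} (hx : Function.Injective x) :
    (∏ i, ∏ j, if i < j then x j - x i else 1) ≠ 0 := by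
  refine Finset.prod_ne_zero_iff.2 fun i _ => Finset.prod_ne_zero_iff.2 fun j _ => ?_
  split_ifs with h
  · exact sub_ne_zero.2 fun e => h.ne' (hx e)
  · exact one_ne_zero

/-- Cleared of denominators, the determinant is a polynomial in `a` of degree at most `2 n`. It
vanishes at every `x i`, where two rows coincide, so it is determined by its values at the `y k`;
there the Laplace expansion keeps a single minor. -/
theorem izerginRat_snoc {ρ : ℂ} {n : ℕ} {x : Fin n → ℂ} {a : ℂ} {y : Fin (n + 1) → ℂ}
    (hx : Function.Injective x) (hy : Function.Injective y) (hax : ∀ i, x i ≠ a)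
    (hxy : ∀ i j, x i ≠ y j) (hay : ∀ j, a ≠ y j) (hxρ : ∀ i j, x i * ρ ≠ y j)
    (haρ : ∀ j, a * ρ ≠ y j) :
    izerginRat ρ (Fin.snoc x a : Fin (n + 1) → ℂ) y =
      ∑ k, (ρ - 1) / (a * ρ - y k) *
        (∏ i, (a - y (k.succAbove i)) * (y k * ρ - y (k.succAbove i)) /
          ((a * ρ - y (k.succAbove i)) * (y k - y (k.succAbove i)))) *
        izerginRat ρ x (fun i => y (k.succAbove i)) := by
  let Δ : Fin (n + 1) → ℂ := fun k => (Matrix.of fun i j =>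
    (ρ - 1) / ((x i * ρ - y (k.succAbove j)) * (x i - y (k.succAbove j)))).det
  have laplace (b : ℂ) : (Matrix.of fun i j => (ρ - 1) /
      (((Fin.snoc x b : Fin (n + 1) → ℂ) i * ρ - y j) *
        ((Fin.snoc x b : Fin (n + 1) → ℂ) i - y j))).det =
      ∑ j : Fin (n + 1), (-1) ^ (n + (j : ℕ)) * ((ρ - 1) / ((b * ρ - y j) * (b - y j))) * Δ j := by
    rw [Matrix.det_succ_row _ (Fin.last n)]
    refine Finset.sum_congr rfl fun j _ => ?_
    simp only [Matrix.of_apply, Fin.snoc_last, Fin.val_last]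
    congr 1
    simp only [Δ]
    congr 1
    ext i k
    simp
  let P : Polynomial ℂ := ∑ j : Fin (n + 1), Polynomial.C ((-1) ^ (n + (j : ℕ)) * (ρ - 1) * Δ j) *
    ∏ i, ((Polynomial.X * Polynomial.C ρ - Polynomial.C (y (j.succAbove i))) *
      (Polynomial.X - Polynomial.C (y (j.succAbove i))))
  have hP : P.degree < (2 * n + 1 : ℕ) := by
    refine lt_of_le_of_lt (Polynomial.degree_sum_le _ _) ?_
    rw [Finset.sup_lt_iff (WithBot.bot_lt_coe _)]
    intro k _
    rw [← Polynomial.smul_eq_C_mul]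
    refine lt_of_le_of_lt (Polynomial.degree_smul_le _ _) ?_
    refine lt_of_le_of_lt (Polynomial.degree_prod_le _ _) ?_
    refine lt_of_le_of_lt (Finset.sum_le_sum (g := fun _ => (2 : WithBot ℕ)) fun i _ => ?_) ?_
    · compute_degree
    · simp
      norm_cast
      lia
  have hPe (b : ℂ) : P.eval b = ∑ j : Fin (n + 1), ((-1) ^ (n + (j : ℕ)) * (ρ - 1) * Δ j) *
      ∏ i, ((b * ρ - y (j.succAbove i)) * (b - y (j.succAbove i))) := by
    simp only [P, Polynomial.eval_finsetSum, Polynomial.eval_mul, Polynomial.eval_prod,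
      Polynomial.eval_sub, Polynomial.eval_X, Polynomial.eval_C]
  have hPd (b : ℂ) (h1 : ∀ j, b * ρ ≠ y j) (h2 : ∀ j, b ≠ y j) : (Matrix.of fun i j => (ρ - 1) /
      (((Fin.snoc x b : Fin (n + 1) → ℂ) i * ρ - y j) *
        ((Fin.snoc x b : Fin (n + 1) → ℂ) i - y j))).det =
      P.eval b / ∏ j, ((b * ρ - y j) * (b - y j)) := by
    rw [laplace, hPe, Finset.sum_div]
    refine Finset.sum_congr rfl fun j _ => ?_
    rw [Fin.prod_univ_succAbove _ j]
    have n1 := sub_ne_zero.2 (h1 j)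
    have n2 := sub_ne_zero.2 (h2 j)
    have n3 : ∏ i, ((b * ρ - y (j.succAbove i)) * (b - y (j.succAbove i))) ≠ 0 :=
      Finset.prod_ne_zero_iff.2 fun i _ =>
        mul_ne_zero (sub_ne_zero.2 (h1 _)) (sub_ne_zero.2 (h2 _))
    generalize ∏ i, ((b * ρ - y (j.succAbove i)) * (b - y (j.succAbove i))) = d at *
    generalize b * ρ - y j = d1 at *
    generalize b - y j = d2 at *
    field_simp
  have hroot (i : Fin n) : P.eval (x i) = 0 := by
    have e := hPd (x i) (hxρ i) (hxy i)
    rw [Matrix.det_zero_of_row_eq (i := i.castSucc) (j := Fin.last n)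
      (Fin.castSucc_lt_last i).ne (by ext; simp)] at e
    have n3 : ∏ j, ((x i * ρ - y j) * (x i - y j)) ≠ 0 := Finset.prod_ne_zero_iff.2 fun j _ =>
        mul_ne_zero (sub_ne_zero.2 (hxρ _ _)) (sub_ne_zero.2 (hxy _ _))
    field_simp at e
    simpa using e.symm
  have hPy (k : Fin (n + 1)) : P.eval (y k) = ((-1) ^ (n + (k : ℕ)) * (ρ - 1) * Δ k) *
      ∏ i, ((y k * ρ - y (k.succAbove i)) * (y k - y (k.succAbove i))) := by
    rw [hPe, Finset.sum_eq_single k]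
    · intro j _ hjk
      obtain ⟨i, hi⟩ := Fin.exists_succAbove_eq hjk.symm
      rw [Finset.prod_eq_zero (Finset.mem_univ i) (by simp [hi]), mul_zero]
    · simp
  rw [izerginRat, hPd a haρ hay, eval_eq_sum_of_roots hP hx hy hxy hroot a, Finset.sum_div,
    Finset.mul_sum]
  refine Finset.sum_congr rfl fun k _ => ?_
  rw [hPy, izerginRat, prod_prod_lt_succAbove _ (Fin.last n),
    prod_prod_lt_succAbove (fun i j => y j - y i) k, Fin.prod_univ_castSucc,
    Fin.prod_univ_succAbove (fun j => (a * ρ - y j) * (a - y j)) k]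
  simp only [Fin.succAbove_last, Fin.snoc_castSucc, Fin.snoc_last]
  have e1 : (∏ i : Fin n, if Fin.last n < i.castSucc then a - x i else x i - a) =
      ∏ i, (x i - a) :=
    Finset.prod_congr rfl fun i _ => if_neg (Fin.castSucc_lt_last i).not_gt
  have e2 : (∏ i, if k < k.succAbove i then y (k.succAbove i) - y k
      else y k - y (k.succAbove i)) = (-1) ^ (n + (k : ℕ)) * ∏ i, (y k - y (k.succAbove i)) := by
    rw [← prod_sign_succAbove, ← Finset.prod_mul_distrib]
    exact Finset.prod_congr rfl fun i _ => by split_ifs <;> ring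
  have e3 : ∏ i, ∏ j, (x i - y j) =
      (∏ i, ∏ j, (x i - y (k.succAbove j))) * ∏ i, (x i - y k) := by
    rw [← Finset.prod_mul_distrib]
    exact Finset.prod_congr rfl fun i _ => by rw [Fin.prod_univ_succAbove _ k, mul_comm]
  have e4 : ∏ j, (a - y j) = (a - y k) * ∏ i, (a - y (k.succAbove i)) :=
    Fin.prod_univ_succAbove _ k
  have e5 : ∏ i, (a - x i) = (-1) ^ n * ∏ i, (x i - a) := by
    have : ((-1) ^ n : ℂ) = ∏ i : Fin n, (-1) := by simp
    rw [this, ← Finset.prod_mul_distrib]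
    exact Finset.prod_congr rfl fun i _ => by ring
  have e6 : ∏ i, (y k - x i) = (-1) ^ n * ∏ i, (x i - y k) := by
    have : ((-1) ^ n : ℂ) = ∏ i : Fin n, (-1) := by simp
    rw [this, ← Finset.prod_mul_distrib]
    exact Finset.prod_congr rfl fun i _ => by ring
  have n1 : ∏ i, (x i - a) ≠ 0 := Finset.prod_ne_zero_iff.2 fun i _ => sub_ne_zero.2 (hax i)
  have n2 : ∏ i, (x i - y k) ≠ 0 := Finset.prod_ne_zero_iff.2 fun i _ => sub_ne_zero.2 (hxy i k)
  have n3 : ∏ i, (y k - y (k.succAbove i)) ≠ 0 := Finset.prod_ne_zero_iff.2 fun i _ =>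
    sub_ne_zero.2 fun h => Fin.succAbove_ne k i (hy h).symm
  have n4 : ∏ i, (a * ρ - y (k.succAbove i)) ≠ 0 := Finset.prod_ne_zero_iff.2 fun i _ =>
    sub_ne_zero.2 (haρ _)
  have n5 : ∏ i, (a - y (k.succAbove i)) ≠ 0 := Finset.prod_ne_zero_iff.2 fun i _ =>
    sub_ne_zero.2 (hay _)
  have n6 := sub_ne_zero.2 (haρ k)
  have n7 := sub_ne_zero.2 (hay k)
  have n8 : (∏ i, ∏ j, if i < j then x i - x j else 1) ≠ 0 := by
    refine Finset.prod_ne_zero_iff.2 fun i _ => Finset.prod_ne_zero_iff.2 fun j _ => ?_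
    split_ifs with h
    · exact sub_ne_zero.2 fun e => h.ne (hx e)
    · exact one_ne_zero
  have n9 := prod_prod_lt_ne_zero (hy.comp Fin.succAbove_right_injective : Function.Injective
    (y ∘ k.succAbove))
  simp only [Function.comp] at n9
  have n10 : ((-1) ^ n : ℂ) ≠ 0 := by simp
  have n11 : ((-1) ^ (n + (k : ℕ)) : ℂ) ≠ 0 := by simp
  have hΔ : (Matrix.of fun i j =>
    (ρ - 1) / ((x i * ρ - y (k.succAbove j)) * (x i - y (k.succAbove j)))).det = Δ k := rfl
  rw [hΔ]
  simp only [e1, e2, e3, e4, e5, e6, Finset.prod_div_distrib, Finset.prod_mul_distrib]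
  generalize ∏ i, (x i - a) = f1 at *
  generalize ∏ i, (x i - y k) = f2 at *
  generalize ∏ i, (y k - y (k.succAbove i)) = f3 at *
  generalize ∏ i, (a * ρ - y (k.succAbove i)) = f4 at *
  generalize ∏ i, (a - y (k.succAbove i)) = f5 at *
  generalize a * ρ - y k = f6 at *
  generalize a - y k = f7 at *
  generalize (∏ i, ∏ j, if i < j then x i - x j else 1) = f8 at *
  generalize (∏ i, ∏ j, if i < j then y (k.succAbove j) - y (k.succAbove i) else 1) = f9 at *
  generalize ((-1) ^ n : ℂ) = f10 at *
  generalize ((-1) ^ (n + (k : ℕ)) : ℂ) = f11 at *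
  field_simp

/-! ### Resolution of the identity -/

/-- Reversal of the sites. -/
def configRev (n : ℕ) : Config n ≃ Config n := Equiv.arrowCongr Fin.revPerm (Equiv.refl _)

theorem configRev_apply {n : ℕ} (s : Config n) : configRev n s = s ∘ Fin.rev := rfl

theorem comp_rev_rev {n : ℕ} {α : Type*} (s : Fin n → α) : (s ∘ Fin.rev) ∘ Fin.rev = s := by
  funext k
  simp

theorem Generic.rev {q : ℂ} {n : ℕ} {s : Fin n → ℂ} (h : Generic q s) :
    Generic q (s ∘ Fin.rev) :=
  ⟨h.1, fun _ _ hjk => h.2 _ _ (by simpa using hjk), fun _ _ => h.3 _ _⟩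

/-- The components of the dual factorizing basis vector labelled by `S`, not normalised. -/
def dualVec (q : ℂ) {n : ℕ} (s : Fin n → ℂ) (S t : Config n) : ℂ :=
  factorVec q (s ∘ Fin.rev) (S ∘ Fin.rev) (t ∘ Fin.rev)

theorem eigD_rev (q : ℂ) {n : ℕ} (s : Fin n → ℂ) (S : Config n) (p : ℂ) :
    eigD q (s ∘ Fin.rev) (S ∘ Fin.rev) p = eigD q s S p :=
  Equiv.prod_comp Fin.revPerm fun k => if S k = 0 then bWeight q p (s k) else 1

theorem monodromy_sqrtWeights_rev (q p : ℂ) {n : ℕ} (s : Fin n → ℂ) (i j : Fin 2)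
    (u t : Config n) : monodromy (fun k => sqrtWeights q p (s k)) i j u t =
      monodromy (fun k => sqrtWeights q p ((s ∘ Fin.rev) k)) j i (t ∘ Fin.rev) (u ∘ Fin.rev) :=
  monodromy_rev (fun k => sqrtWeights q p (s k)) (fun _ => rfl) i j u t

/-- Transposing `D` amounts to reversing the chain, so right eigenvectors of the reversed chain are
left eigenvectors here. -/
theorem dualVec_monodromy {q : ℂ} {n : ℕ} {s : Fin n → ℂ} (h : Generic q s) (S : Config n)
    {p : ℂ} (hp : ∀ k, p ^ 2 * q ^ 2 ≠ s k ^ 2) (t : Config n) :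
    ∑ u, dualVec q s S u * monodromy (fun k => sqrtWeights q p (s k)) 1 1 u t =
      eigD q s S p * dualVec q s S t := by
  rw [dualVec, ← eigD_rev, ← (monodromy_factorVec h.rev _ (fun k => hp _) _).1,
    ← (configRev n).sum_comp]
  refine Finset.sum_congr rfl fun u _ => ?_
  rw [monodromy_sqrtWeights_rev, dualVec, mul_comm, configRev_apply, comp_rev_rev]

/-- Left and right eigenvectors for different eigenvalues are orthogonal. The operator `D(s k)`
separates labels differing at `k`, since its eigenvalue vanishes exactly when the label is `0` at
`k`. -/
theorem sum_dualVec_mul_factorVec_of_ne {q : ℂ} {n : ℕ} {s : Fin n → ℂ} (h : Generic q s)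
    {S T : Config n} (hST : S ≠ T) : ∑ t, dualVec q s S t * factorVec q s T t = 0 := by
  have key (p : ℂ) (hp : ∀ k, p ^ 2 * q ^ 2 ≠ s k ^ 2) :
      eigD q s S p * (∑ t, dualVec q s S t * factorVec q s T t) =
        eigD q s T p * ∑ t, dualVec q s S t * factorVec q s T t := by
    have e1 : ∑ t, (∑ u, dualVec q s S u * monodromy (fun k => sqrtWeights q p (s k)) 1 1 u t) *
        factorVec q s T t = eigD q s S p * ∑ t, dualVec q s S t * factorVec q s T t := by
      simp only [dualVec_monodromy h S hp, Finset.mul_sum, mul_assoc]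
    have e2 : ∑ u, dualVec q s S u * (∑ t, monodromy (fun k => sqrtWeights q p (s k)) 1 1 u t *
        factorVec q s T t) = eigD q s T p * ∑ t, dualVec q s S t * factorVec q s T t := by
      simp only [(monodromy_factorVec h T hp _).1, Finset.mul_sum]
      exact Finset.sum_congr rfl fun u _ => by ring
    rw [← e1, ← e2]
    simp only [Finset.mul_sum, Finset.sum_mul]
    rw [Finset.sum_comm]
    exact Finset.sum_congr rfl fun u _ => Finset.sum_congr rfl fun t _ => by ring
  have eig_zero (U : Config n) (k : Fin n) (hk : U k = 0) : eigD q s U (s k) = 0 :=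
    Finset.prod_eq_zero (Finset.mem_univ k) (by simp [hk, bWeight])
  have eig_ne (U : Config n) (k : Fin n) (hk : U k ≠ 0) : eigD q s U (s k) ≠ 0 :=
    eigD_ne_zero h.1 (fun j hj => h.2 _ _ fun e => hk (e ▸ hj)) (h.3 k)
  obtain ⟨k, hk⟩ := Function.ne_iff.1 hST
  have e := key (s k) (h.3 k)
  by_cases hS : S k = 0
  · have hT : T k ≠ 0 := fun hT => hk (hS.trans hT.symm)
    rw [eig_zero S k hS, zero_mul, eq_comm, mul_eq_zero] at e
    exact e.resolve_left (eig_ne T k hT)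
  · have hT : T k = 0 := by
      generalize S k = a at *
      generalize T k = b at *
      lia
    rw [eig_zero T k hT, zero_mul, mul_eq_zero] at e
    exact e.resolve_left (eig_ne S k hS)

/-- The sum of `θ` over the sites `k` with `S k = 0`. -/
def height {n : ℕ} (θ : Fin n → ℤ) (S : Config n) : ℤ := ∑ k, if S k = 0 then θ k else 0

theorem height_succ {n : ℕ} (θ : Fin (n + 1) → ℤ) (S : Config (n + 1)) :
    height θ S = height (θ ∘ Fin.castSucc) (S ∘ Fin.castSucc) +
      if S (Fin.last n) = 0 then θ (Fin.last n) else 0 := by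
  simp [height, Fin.sum_univ_castSucc]

theorem height_update {n : ℕ} (θ : Fin n → ℤ) {S : Config n} {k : Fin n} (hk : S k = 0) :
    height θ S = height θ (Function.update S k 1) + θ k := by
  rw [height, height, ← Finset.add_sum_erase _ _ (Finset.mem_univ k),
    ← Finset.add_sum_erase _ _ (Finset.mem_univ k)]
  rw [Finset.sum_congr rfl (g := fun j => if Function.update S k 1 j = 0 then θ j else 0)]
  · simp [hk, add_comm]
  · intro j hj
    rw [Function.update_of_ne (Finset.ne_of_mem_erase hj)]

/-- The factorizing basis is triangular with respect to the standard basis. -/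
theorem factorVec_triangular {q : ℂ} {n : ℕ} {s : Fin n → ℂ} {S t : Config n}
    (h : factorVec q s S t ≠ 0) {θ : Fin n → ℤ} (hθ : StrictMono θ) :
    t = S ∨ height θ S < height θ t := by
  induction n with
  | zero => exact Or.inl (Subsingleton.elim _ _)
  | succ n ih =>
    have hθ' : StrictMono (θ ∘ Fin.castSucc) := hθ.comp Fin.strictMono_castSucc
    have hext (hl : t (Fin.last n) = S (Fin.last n))
        (hc : t ∘ Fin.castSucc = S ∘ Fin.castSucc) : t = S := by
      funext k
      exact Fin.lastCases hl (fun i => congrFun hc i) k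
    rw [factorVec] at h
    rw [height_succ θ S, height_succ θ t]
    split_ifs at h with h1 h2 h2
    · rcases ih h hθ' with e | e
      · exact Or.inl (hext (h2.trans h1.symm) e)
      · right
        simpa [h1, h2] using e
    · simp at h
    -- A site `k` of the label is traded for the last site, where `θ` is larger.
    · obtain ⟨k, -, hk⟩ := Finset.exists_ne_zero_of_sum_ne_zero h
      split_ifs at hk with hk0
      · right
        have e := height_update (θ ∘ Fin.castSucc) hk0
        have hlt : (θ ∘ Fin.castSucc) k < θ (Fin.last n) := hθ (Fin.castSucc_lt_last k)
        rw [if_neg h1, if_pos h2]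
        rcases ih (right_ne_zero_of_mul hk) hθ' with e' | e'
        · rw [← e'] at e
          lia
        · lia
      · simp at hk
    · rcases ih (right_ne_zero_of_mul h) hθ' with e | e
      · refine Or.inl (hext ?_ e)
        generalize t (Fin.last n) = a at *
        generalize S (Fin.last n) = b at *
        lia
      · right
        simpa [h1, h2] using e

theorem factorVec_self (q : ℂ) {n : ℕ} (s : Fin n → ℂ) (S : Config n) :
    factorVec q s S S =
      ∏ j, ∏ k, if k < j ∧ S j ≠ 0 ∧ S k = 0 then bWeight q (s j) (s k) else 1 := by
  induction n with
  | zero => simp [factorVec]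
  | succ n ih =>
    have e : factorVec q s S S = factorVec q (s ∘ Fin.castSucc) (S ∘ Fin.castSucc)
        (S ∘ Fin.castSucc) * if S (Fin.last n) ≠ 0 then
          eigD q (s ∘ Fin.castSucc) (S ∘ Fin.castSucc) (s (Fin.last n)) else 1 := by
      by_cases h : S (Fin.last n) = 0
      · simp [factorVec, h]
      · simp [factorVec, h, mul_comm]
    rw [e, ih]
    simp only [Fin.prod_univ_castSucc (n := n), Fin.castSucc_lt_castSucc_iff,
      Fin.castSucc_lt_last, (Fin.castSucc_lt_last _).not_gt, false_and, if_false, mul_one, true_and,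
      lt_self_iff_false, eigD, Function.comp]
    congr 1
    split_ifs with h <;> simp [h]

/-- The pairing of a factorizing basis vector with its dual vector. -/
def pairing (q : ℂ) {n : ℕ} (s : Fin n → ℂ) (S : Config n) : ℂ :=
  ∏ j, ∏ k, if S j ≠ 0 ∧ S k = 0 then bWeight q (s j) (s k) else 1

theorem pairing_ne_zero {q : ℂ} {n : ℕ} {s : Fin n → ℂ} (h : Generic q s) (S : Config n) :
    pairing q s S ≠ 0 := by
  refine Finset.prod_ne_zero_iff.2 fun j _ => Finset.prod_ne_zero_iff.2 fun k _ => ?_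
  split_ifs with hjk
  · exact bWeight_ne_zero h.1 (h.2 _ _ fun e => hjk.1 (e ▸ hjk.2)) (h.3 _ _)
  · exact one_ne_zero

theorem sum_dualVec_mul_factorVec_self (q : ℂ) {n : ℕ} (s : Fin n → ℂ) (S : Config n) :
    ∑ t, dualVec q s S t * factorVec q s S t = pairing q s S := by
  rw [Finset.sum_eq_single S]
  · rw [dualVec, factorVec_self, factorVec_self, pairing]
    have e : (∏ j : Fin n, ∏ k : Fin n, if k < j ∧ (S ∘ Fin.rev) j ≠ 0 ∧ (S ∘ Fin.rev) k = 0 then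
        bWeight q ((s ∘ Fin.rev) j) ((s ∘ Fin.rev) k) else 1) =
        ∏ j, ∏ k, if j < k ∧ S j ≠ 0 ∧ S k = 0 then bWeight q (s j) (s k) else 1 := by
      rw [← Equiv.prod_comp Fin.revPerm]
      refine Finset.prod_congr rfl fun j _ => ?_
      rw [← Equiv.prod_comp Fin.revPerm]
      simp
    rw [e]
    simp only [← Finset.prod_mul_distrib]
    refine Finset.prod_congr rfl fun j _ => Finset.prod_congr rfl fun k _ => ?_
    rcases lt_trichotomy j k with h | h | h
    · simp [h, h.not_gt]
    · subst h; simp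
    · simp [h, h.not_gt]
  · intro t _ ht
    by_contra hne
    -- A term with `t ≠ S` would have to raise the height by triangularity of the basis, and lower
    -- it by triangularity of the reversed one.
    have hθ : StrictMono fun k : Fin n => (k : ℤ) := fun a b hab => by simpa using hab
    have hθ' : StrictMono fun k : Fin n => -((Fin.rev k : Fin n) : ℤ) := fun a b hab => by
      simpa using Fin.rev_lt_rev.2 hab
    have h1 := (factorVec_triangular (right_ne_zero_of_mul hne) hθ).resolve_left ht
    have h2 := (factorVec_triangular (left_ne_zero_of_mul hne) hθ').resolve_left fun e => ht (by
      rw [← comp_rev_rev t, e, comp_rev_rev])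
    have e (U : Config n) : height (fun k : Fin n => -((Fin.rev k : Fin n) : ℤ)) (U ∘ Fin.rev) =
        -height (fun k : Fin n => (k : ℤ)) U := by
      rw [height, height, ← Equiv.sum_comp Fin.revPerm, ← Finset.sum_neg_distrib]
      refine Finset.sum_congr rfl fun k _ => ?_
      simp only [Fin.revPerm_apply, Function.comp, Fin.rev_rev]
      split_ifs <;> simp
    rw [e, e] at h2
    lia
  · simp

/-- Biorthogonality says that one square matrix is a left inverse of another; in finite dimension it
is then a right inverse, which is completeness. -/
theorem sum_mul_eq_sum_factorVec {q : ℂ} {n : ℕ} {s : Fin n → ℂ} (h : Generic q s)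
    (x y : Config n → ℂ) :
    ∑ t, x t * y t = ∑ S, (∑ t, x t * factorVec q s S t) * (pairing q s S)⁻¹ *
      ∑ t, dualVec q s S t * y t := by
  let V : Op n := Matrix.of fun t S => factorVec q s S t
  let W : Op n := Matrix.of fun S t => (pairing q s S)⁻¹ * dualVec q s S t
  have hWV : W * V = 1 := by
    ext S T
    simp only [W, V, Matrix.mul_apply, Matrix.of_apply, mul_assoc, ← Finset.mul_sum]
    by_cases hST : S = T
    · subst hST
      rw [sum_dualVec_mul_factorVec_self, inv_mul_cancel₀ (pairing_ne_zero h S), Matrix.one_apply_eq]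
    · rw [sum_dualVec_mul_factorVec_of_ne h hST, mul_zero, Matrix.one_apply_ne hST]
  have hVW : V * W = 1 := mul_eq_one_comm.1 hWV
  have e1 : x ⬝ᵥ ((V * W) *ᵥ y) = (x ᵥ* V) ⬝ᵥ (W *ᵥ y) := by
    rw [← Matrix.mulVec_mulVec, Matrix.dotProduct_mulVec]
  rw [hVW, Matrix.one_mulVec] at e1
  refine e1.trans (Finset.sum_congr rfl fun S _ => ?_)
  simp only [V, W, Matrix.vecMul, Matrix.mulVec, dotProduct, Matrix.of_apply, mul_assoc,
    ← Finset.mul_sum]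

/-! ### Domain wall partition functions -/

/-- The Izergin determinant expression in terms of square roots of the parameters. -/
def sqrtIzergin (q : ℂ) {M : ℕ} (p σ : Fin M → ℂ) : ℂ :=
  (∏ k, p k * σ k) * izerginRat (q ^ 2) (fun k => p k ^ 2) fun k => σ k ^ 2

theorem izergin_eq_sqrtIzergin {r : ℂ → ℂ} (hr : ∀ u, r u ^ 2 = u) (ρ : ℂ) {M : ℕ}
    (μ ξ : Fin M → ℂ) :
    izergin r ρ μ ξ = sqrtIzergin (r ρ) (fun k => r (μ k)) fun k => r (ξ k) := by
  have e : (∏ p, ∏ q with p < q, (μ p - μ q) * (ξ q - ξ p)) =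
      (∏ i, ∏ j, if i < j then μ i - μ j else 1) * ∏ i, ∏ j, if i < j then ξ j - ξ i else 1 := by
    simp only [← Finset.prod_mul_distrib, Finset.prod_filter]
    refine Finset.prod_congr rfl fun i _ => Finset.prod_congr rfl fun j _ => ?_
    split_ifs <;> simp
  simp only [izergin, sqrtIzergin, izerginRat, hr, e]
  ring

/-- The recursion `izerginRat_snoc` in terms of the weights, where its coefficients take the form of
`coeffB`. -/
theorem sqrtIzergin_succ {q : ℂ} {M : ℕ} {p σ : Fin (M + 1) → ℂ}
    (hp : Function.Injective fun i => p i ^ 2) (hσ : Function.Injective fun i => σ i ^ 2)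
    (hpσ : ∀ i j, p i ^ 2 ≠ σ j ^ 2) (hpq : ∀ i j, p i ^ 2 * q ^ 2 ≠ σ j ^ 2)
    (hσq : ∀ i j, σ i ^ 2 * q ^ 2 ≠ σ j ^ 2) (hq : q ≠ 0) :
    sqrtIzergin q p σ = ∑ k, cWeight q (p (Fin.last M)) (σ k) *
      (∏ i, bWeight q (p (Fin.last M)) (σ (k.succAbove i))) /
      (∏ i, bWeight q (σ k) (σ (k.succAbove i))) *
        sqrtIzergin q (fun i => p i.castSucc) fun i => σ (k.succAbove i) := by
  have e : (fun i => p i ^ 2) =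
      (Fin.snoc (fun i : Fin M => p i.castSucc ^ 2) (p (Fin.last M) ^ 2) : Fin (M + 1) → ℂ) := by
    funext i
    refine Fin.lastCases ?_ (fun j => ?_) i <;> simp
  rw [sqrtIzergin, e, izerginRat_snoc (fun i j h => by simpa using hp h) hσ
    (fun i h => (Fin.castSucc_lt_last i).ne (hp h)) (fun _ _ => hpσ _ _) (hpσ _)
    (fun _ _ => hpq _ _) (hpq _), Finset.mul_sum]
  refine Finset.sum_congr rfl fun k _ => ?_
  rw [sqrtIzergin, Finset.prod_mul_distrib, Finset.prod_mul_distrib,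
    Fin.prod_univ_castSucc p, Fin.prod_univ_succAbove σ k]
  have e2 : ∏ i, bWeight q (p (Fin.last M)) (σ (k.succAbove i)) /
      bWeight q (σ k) (σ (k.succAbove i)) = ∏ i, (p (Fin.last M) ^ 2 - σ (k.succAbove i) ^ 2) *
        (σ k ^ 2 * q ^ 2 - σ (k.succAbove i) ^ 2) / ((p (Fin.last M) ^ 2 * q ^ 2 -
          σ (k.succAbove i) ^ 2) * (σ k ^ 2 - σ (k.succAbove i) ^ 2)) := by
    refine Finset.prod_congr rfl fun i _ => ?_
    have n1 := sub_ne_zero.2 (hσq k (k.succAbove i))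
    have n2 := sub_ne_zero.2 (hpq (Fin.last M) (k.succAbove i))
    have n3 := sub_ne_zero.2 (show σ k ^ 2 ≠ σ (k.succAbove i) ^ 2 from
      fun h => Fin.succAbove_ne k i (hσ h).symm)
    rw [bWeight, bWeight]
    generalize σ k ^ 2 * q ^ 2 - σ (k.succAbove i) ^ 2 = d1 at *
    generalize p (Fin.last M) ^ 2 * q ^ 2 - σ (k.succAbove i) ^ 2 = d2 at *
    generalize σ k ^ 2 - σ (k.succAbove i) ^ 2 = d3 at *
    field_simp
  rw [mul_div_assoc, ← Finset.prod_div_distrib, e2, cWeight]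
  ring

/-- The label with value `0` exactly on the range of `l`. -/
def rangeConfig {M n : ℕ} (l : Fin M → Fin n) : Config n :=
  fun k => if ∃ m, l m = k then 0 else 1

theorem rangeConfig_eq_zero {M n : ℕ} {l : Fin M → Fin n} {k : Fin n} :
    rangeConfig l k = 0 ↔ ∃ m, l m = k := by
  simp [rangeConfig]

theorem update_rangeConfig {M n : ℕ} {l : Fin (M + 1) → Fin n} (hl : Function.Injective l)
    (k : Fin (M + 1)) :
    Function.update (rangeConfig l) (l k) 1 = rangeConfig fun i => l (k.succAbove i) := by
  funext j
  by_cases hj : j = l k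
  · subst hj
    rw [Function.update_self, rangeConfig, if_neg]
    rintro ⟨m, hm⟩
    exact Fin.succAbove_ne k m (hl hm)
  · have e : (∃ m, l m = j) ↔ ∃ m, l (k.succAbove m) = j := by
      rw [Fin.exists_iff_succAbove k]
      simp [Ne.symm hj]
    simp only [Function.update_of_ne hj, rangeConfig, e]

theorem prod_rangeConfig {M n : ℕ} {l : Fin M → Fin n} (hl : Function.Injective l)
    (f : Fin n → ℂ) : (∏ k, if rangeConfig l k = 0 then f k else 1) = ∏ m, f (l m) := by
  rw [← Finset.prod_filter, ← Finset.prod_image (f := f) (s := Finset.univ) (g := l)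
    (fun a _ b _ h => hl h)]
  refine Finset.prod_congr ?_ fun _ _ => rfl
  ext k
  simp [rangeConfig_eq_zero]

theorem sum_rangeConfig {M n : ℕ} {l : Fin M → Fin n} (hl : Function.Injective l)
    (f : Fin n → ℂ) : (∑ k, if rangeConfig l k = 0 then f k else 0) = ∑ m, f (l m) := by
  rw [← Finset.sum_filter, ← Finset.sum_image (f := f) (s := Finset.univ) (g := l)
    (fun a _ b _ h => hl h)]
  refine Finset.sum_congr ?_ fun _ _ => rfl
  ext k
  simp [rangeConfig_eq_zero]

theorem factorVec_refState (q : ℂ) {n : ℕ} (s : Fin n → ℂ) (S : Config n) :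
    factorVec q s S (fun _ => 1) = if S = fun _ => 1 then 1 else 0 := by
  induction n with
  | zero => simp [factorVec, Subsingleton.elim S fun _ => 1]
  | succ n ih =>
    have e : S = (fun _ => 1) ↔ S ∘ Fin.castSucc = (fun _ => 1) ∧ S (Fin.last n) = 1 := by
      simp only [funext_iff, Fin.forall_fin_succ', Function.comp]
    rw [factorVec]
    have hc : (fun _ => 1 : Config (n + 1)) ∘ Fin.castSucc = fun _ => 1 := rfl
    simp only [hc, ih, e]
    by_cases h1 : S (Fin.last n) = 0
    · simp [h1]
    · have h1' : S (Fin.last n) = 1 := by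
        generalize S (Fin.last n) = a at *
        lia
      by_cases h2 : S ∘ Fin.castSucc = fun _ => 1
      · have h3 : ∀ x, S (Fin.castSucc x) = 1 := fun x => congrFun h2 x
        simp [h1', h2, h3, eigD]
      · simp [h1', h2]

/-- The component of `⟨1| B(p₁) ⋯ B(p_M)` along the factorizing basis vector `S`. -/
def wallSum (q : ℂ) {n M : ℕ} (s : Fin n → ℂ) (p : Fin M → ℂ) (S : Config n) : ℂ :=
  ∑ t, (List.ofFn fun m => opB fun k => sqrtWeights q (p m) (s k)).prod (fun _ => 1) t *
    factorVec q s S t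

theorem wallSum_zero (q : ℂ) {n : ℕ} (s : Fin n → ℂ) (p : Fin 0 → ℂ) (S : Config n) :
    wallSum q s p S = if S = fun _ => 1 then 1 else 0 := by
  simp [wallSum, Matrix.one_apply, factorVec_refState]

theorem wallSum_succ {q : ℂ} {n M : ℕ} {s : Fin n → ℂ} (h : Generic q s) {p : Fin (M + 1) → ℂ}
    (hp : ∀ m k, p m ^ 2 * q ^ 2 ≠ s k ^ 2) (S : Config n) :
    wallSum q s p S = ∑ k, if S k = 0 then coeffB q s S (p (Fin.last M)) k *
      wallSum q s (fun m => p m.castSucc) (Function.update S k 1) else 0 := by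
  simp only [wallSum, List.ofFn_succ', List.concat_eq_append, List.prod_append, List.prod_singleton,
    Matrix.mul_apply, Finset.sum_mul]
  rw [Finset.sum_comm]
  simp only [mul_assoc, ← Finset.mul_sum, opB]
  simp only [(monodromy_factorVec h S (hp (Fin.last M)) _).2]
  rw [sum_mul_sum_ite]

/-- With `θ = 1` the height is the number of sites in the label. Each `B` removes one of them, and
only the empty label pairs with the reference state. -/
theorem wallSum_eq_zero {q : ℂ} {n M : ℕ} {s : Fin n → ℂ} (h : Generic q s) {p : Fin M → ℂ}
    (hp : ∀ m k, p m ^ 2 * q ^ 2 ≠ s k ^ 2) {S : Config n} (hS : height (fun _ => 1) S ≠ M) :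
    wallSum q s p S = 0 := by
  induction M generalizing S with
  | zero =>
    rw [wallSum_zero, if_neg]
    rintro rfl
    simp [height] at hS
  | succ M ih =>
    rw [wallSum_succ h hp]
    refine Finset.sum_eq_zero fun k _ => ?_
    split_ifs with hk
    · rw [ih (fun _ => hp _), mul_zero]
      rw [height_update _ hk] at hS
      push_cast at hS
      exact fun e => hS (by rw [e])
    · rfl

theorem wallSum_rangeConfig {q : ℂ} {n M : ℕ} {s : Fin n → ℂ} (h : Generic q s) {p : Fin M → ℂ}
    (hpq : ∀ m k, p m ^ 2 * q ^ 2 ≠ s k ^ 2) (hps : ∀ m k, p m ^ 2 ≠ s k ^ 2)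
    (hp : Function.Injective fun m => p m ^ 2) {l : Fin M → Fin n} (hl : Function.Injective l) :
    wallSum q s p (rangeConfig l) = sqrtIzergin q p fun m => s (l m) := by
  induction M with
  | zero =>
    rw [wallSum_zero, if_pos]
    · simp [sqrtIzergin, izerginRat]
    · funext k
      simp [rangeConfig]
  | succ M ih =>
    rw [wallSum_succ h hpq, sum_rangeConfig hl, sqrtIzergin_succ hp
      (fun a b hab => hl (by_contra fun hne => h.2 _ _ hne hab)) (fun _ _ => hps _ _)
      (fun _ _ => hpq _ _) (fun _ _ => h.3 _ _) h.1]
    refine Finset.sum_congr rfl fun k _ => ?_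
    have hlk : Function.Injective fun i => l (k.succAbove i) :=
      hl.comp Fin.succAbove_right_injective
    rw [update_rangeConfig hl, ih (fun _ => hpq _) (fun _ => hps _)
      (fun a b hab => by simpa using hp hab) hlk, coeffB, update_rangeConfig hl]
    simp only [eigD, prod_rangeConfig hlk]

/-! ### The sum formula -/

theorem prod_opC_eq_prod_opB_rev (q : ℂ) {n M : ℕ} (s : Fin n → ℂ) (p : Fin M → ℂ)
    (t u : Config n) :
    (List.ofFn fun m => opC fun k => sqrtWeights q (p m) (s k)).reverse.prod t u =
      (List.ofFn fun m => opB fun k => sqrtWeights q (p m) ((s ∘ Fin.rev) k)).prod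
        (u ∘ Fin.rev) (t ∘ Fin.rev) := by
  induction M generalizing t u with
  | zero =>
    have e : u ∘ Fin.rev = t ∘ Fin.rev ↔ t = u :=
      ((configRev n).injective.eq_iff (a := u) (b := t)).trans eq_comm
    simp [Matrix.one_apply, e]
  | succ M ih =>
    simp only [List.ofFn_succ', List.concat_eq_append, List.reverse_append, List.reverse_singleton,
      List.singleton_append, List.prod_cons, List.prod_append, List.prod_nil,
      mul_one]
    simp only [Matrix.mul_apply, ih]
    rw [← (configRev n).sum_comp]
    refine Finset.sum_congr rfl fun v _ => ?_
    rw [opC, monodromy_sqrtWeights_rev, configRev_apply, comp_rev_rev, mul_comm]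
    rfl

/-- Transposition exchanges `B` and `C`, so the `C` half is again a domain wall sum, on the reversed
chain. -/
theorem sum_dualVec_mul_prod_opC (q : ℂ) {n M : ℕ} (s : Fin n → ℂ) (p : Fin M → ℂ)
    (S : Config n) :
    ∑ t, dualVec q s S t *
        (List.ofFn fun m => opC fun k => sqrtWeights q (p m) (s k)).reverse.prod t (fun _ => 1) =
      wallSum q (s ∘ Fin.rev) p (S ∘ Fin.rev) := by
  rw [wallSum, ← (configRev n).sum_comp]
  refine Finset.sum_congr rfl fun t _ => ?_
  rw [prod_opC_eq_prod_opB_rev, configRev_apply, dualVec, comp_rev_rev, mul_comm]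
  rfl

theorem rangeConfig_comp_rev {M n : ℕ} (l : Fin M → Fin n) :
    rangeConfig l ∘ Fin.rev = rangeConfig fun m => Fin.rev (l m) := by
  funext k
  have e : (∃ m, l m = Fin.rev k) ↔ ∃ m, Fin.rev (l m) = k :=
    exists_congr fun m => Fin.rev_eq_iff.symm
  simp only [rangeConfig, Function.comp, e]

theorem pairing_rangeConfig (q : ℂ) {M n : ℕ} (s : Fin n → ℂ) {l : Fin M → Fin n}
    (hl : Function.Injective l) : pairing q s (rangeConfig l) =
      ∏ m, ∏ j with ∀ k, j ≠ l k, bWeight q (s j) (s (l m)) := by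
  rw [pairing, Finset.prod_comm,
    ← prod_rangeConfig hl (fun k => ∏ j with ∀ i, j ≠ l i, bWeight q (s j) (s k))]
  refine Finset.prod_congr rfl fun k _ => ?_
  by_cases hk : rangeConfig l k = 0
  · simp only [hk, and_true, if_true, Finset.prod_filter, ne_eq, rangeConfig_eq_zero, not_exists]
    refine Finset.prod_congr rfl fun j _ => ?_
    simp only [eq_comm]
  · simp [hk]

theorem sum_config_eq_sum_strictMono {M n : ℕ} (f : Config n → ℂ)
    (hf : ∀ S, height (fun _ => 1) S ≠ M → f S = 0) :
    ∑ S, f S = ∑ l : Fin M → Fin n with StrictMono l, f (rangeConfig l) := by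
  symm
  refine Finset.sum_of_injOn rangeConfig ?_ (fun _ _ => Finset.mem_coe.2 (Finset.mem_univ _)) ?_
    (fun _ _ => rfl)
  · intro l hl l' hl' h
    simp only [Finset.coe_filter, Finset.mem_univ, true_and, Set.mem_ofPred_eq] at hl hl'
    refine (hl.range_inj hl').1 ?_
    ext k
    rw [Set.mem_range, Set.mem_range, ← rangeConfig_eq_zero, ← rangeConfig_eq_zero, h]
  · intro S _ hS
    apply hf
    intro hc
    apply hS
    have hcard : (Finset.univ.filter fun k => S k = 0).card = M := by
      simpa [height, Finset.sum_boole] using hc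
    refine ⟨(Finset.univ.filter fun k => S k = 0).orderEmbOfFin hcard, ?_, ?_⟩
    · simpa using (Finset.orderEmbOfFin _ hcard).strictMono
    · funext k
      have e : (∃ m, (Finset.univ.filter fun k => S k = 0).orderEmbOfFin hcard m = k) ↔
          S k = 0 := by
        rw [← Set.mem_range, Finset.range_orderEmbOfFin]
        simp
      simp only [rangeConfig, e]
      split_ifs with h
      · exact h.symm
      · generalize S k = a at *
        lia

theorem scalarProduct_sqrtWeights_of_generic {q : ℂ} {n M : ℕ} {s : Fin n → ℂ} (h : Generic q s)
    {p p' : Fin M → ℂ}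
    (hpq : ∀ m k, p m ^ 2 * q ^ 2 ≠ s k ^ 2) (hps : ∀ m k, p m ^ 2 ≠ s k ^ 2)
    (hp : Function.Injective fun m => p m ^ 2)
    (hpq' : ∀ m k, p' m ^ 2 * q ^ 2 ≠ s k ^ 2) (hps' : ∀ m k, p' m ^ 2 ≠ s k ^ 2)
    (hp' : Function.Injective fun m => p' m ^ 2) :
    scalarProduct (fun m k => sqrtWeights q (p m) (s k)) (fun m k => sqrtWeights q (p' m) (s k)) =
      q ^ (-((M : ℤ) * ((n : ℤ) - (M : ℤ)))) * ∑ l : Fin M → Fin n with StrictMono l,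
        (∏ m : Fin M, ∏ j : Fin n with ∀ k, j ≠ l k,
            (s j ^ 2 * q ^ 2 - s (l m) ^ 2) / (s j ^ 2 - s (l m) ^ 2)) *
          sqrtIzergin q p (fun k => s (l k)) * sqrtIzergin q p' fun k => s (l k) := by
  rw [scalarProduct_eq_sum, sum_mul_eq_sum_factorVec h]
  simp only [sum_dualVec_mul_prod_opC]
  change ∑ S, wallSum q s p S * (pairing q s S)⁻¹ * wallSum q (s ∘ Fin.rev) p' (S ∘ Fin.rev) = _
  rw [sum_config_eq_sum_strictMono (M := M) _ (fun S hS => by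
    rw [wallSum_eq_zero h hpq hS, zero_mul, zero_mul]), Finset.mul_sum]
  refine Finset.sum_congr rfl fun l hl => ?_
  have hl' : Function.Injective l := (Finset.mem_filter.1 hl).2.injective
  -- Only injectivity of the labelling is required, so the decreasing map `Fin.rev ∘ l` serves on
  -- the reversed chain and both determinants get the same order of columns.
  rw [wallSum_rangeConfig h hpq hps hp hl', rangeConfig_comp_rev,
    wallSum_rangeConfig (p := p') (l := fun m => Fin.rev (l m)) h.rev (fun _ _ => hpq' _ _)
      (fun _ _ => hps' _ _) hp' (Fin.rev_injective.comp hl'), pairing_rangeConfig q s hl']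
  simp only [Function.comp, Fin.rev_rev]
  -- Each of the `n - M` sites outside the subset gives one factor `q`; taken over all `m` and
  -- inverted, this is the power of `q` in front.
  have e (m : Fin M) : ∏ j with ∀ k, j ≠ l k, bWeight q (s j) (s (l m)) =
      q ^ ((n : ℤ) - M) * ∏ j with ∀ k, j ≠ l k,
        ((s j ^ 2 * q ^ 2 - s (l m) ^ 2) / (s j ^ 2 - s (l m) ^ 2))⁻¹ := by
    have hc : ((Finset.univ.filter fun j => ∀ k, j ≠ l k).card : ℤ) = (n : ℤ) - M := by
      have h1 : (Finset.univ.filter fun j => ∀ k, j ≠ l k) = (Finset.univ.image l)ᶜ := by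
        ext j
        simp [eq_comm]
      have h2 : M ≤ n := by simpa using Fintype.card_le_of_injective l hl'
      rw [h1, Finset.card_compl, Finset.card_image_of_injective _ hl', Finset.card_univ,
        Fintype.card_fin, Fintype.card_fin, Nat.cast_sub h2]
    rw [← hc, zpow_natCast, ← Finset.prod_const, ← Finset.prod_mul_distrib]
    refine Finset.prod_congr rfl fun j _ => ?_
    rw [bWeight, inv_div]
  simp only [e, Finset.prod_mul_distrib, Finset.prod_const, Finset.card_univ, Fintype.card_fin,
    Finset.prod_inv_distrib, mul_inv, inv_inv]
  rw [zpow_neg, mul_comm (M : ℤ), zpow_mul, zpow_natCast]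
  ring

/-! ### Removal of the genericity assumptions -/

theorem continuousAt_sqrtIzergin {M : ℕ} {p σ : ℂ → Fin M → ℂ} {q : ℂ → ℂ} {a : ℂ}
    (hq : ContinuousAt q a) (hp : ∀ m, ContinuousAt (fun x => p x m) a)
    (hσ : ∀ m, ContinuousAt (fun x => σ x m) a)
    (hpi : Function.Injective fun m => p a m ^ 2) (hσi : Function.Injective fun m => σ a m ^ 2)
    (hpσ : ∀ m k, p a m ^ 2 ≠ σ a k ^ 2) (hpq : ∀ m k, p a m ^ 2 * q a ^ 2 ≠ σ a k ^ 2) :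
    ContinuousAt (fun x => sqrtIzergin (q x) (p x) (σ x)) a := by
  simp only [sqrtIzergin, izerginRat, Matrix.det_apply, Matrix.of_apply, Units.smul_def,
    zsmul_eq_mul]
  have hfin {ι : Type} (S : Finset ι) (f : ℂ → ι → ℂ) (hf : ∀ i, ContinuousAt (fun x => f x i) a) :
      ContinuousAt (fun x => ∏ i ∈ S, f x i) a := tendsto_finsetProd _ fun i _ => hf i
  refine ContinuousAt.mul (hfin _ _ fun k => (hp k).mul (hσ k)) (ContinuousAt.mul
    (ContinuousAt.div (hfin _ _ fun i => hfin _ _ fun j => ?_) (ContinuousAt.mul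
      (hfin _ _ fun i => hfin _ _ fun j => ?_) (hfin _ _ fun i => hfin _ _ fun j => ?_)) ?_)
    (tendsto_finsetSum _ fun τ _ => continuousAt_const.mul (hfin _ _ fun i =>
      ContinuousAt.div ?_ ?_ ?_)))
  · exact ((hp i).pow 2).sub ((hσ j).pow 2)
  · split_ifs
    · exact ((hp i).pow 2).sub ((hp j).pow 2)
    · exact continuousAt_const
  · split_ifs
    · exact ((hσ j).pow 2).sub ((hσ i).pow 2)
    · exact continuousAt_const
  · refine mul_ne_zero ?_ (prod_prod_lt_ne_zero hσi)
    refine Finset.prod_ne_zero_iff.2 fun i _ => Finset.prod_ne_zero_iff.2 fun j _ => ?_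
    split_ifs with h
    · exact sub_ne_zero.2 fun e => h.ne (hpi e)
    · exact one_ne_zero
  · exact (hq.pow 2).sub continuousAt_const
  · exact ((((hp _).pow 2).mul (hq.pow 2)).sub ((hσ _).pow 2)).mul
      (((hp _).pow 2).sub ((hσ _).pow 2))
  · exact mul_ne_zero (sub_ne_zero.2 (hpq _ _)) (sub_ne_zero.2 (hpσ _ _))

/-- The difference is a nonzero polynomial in `t`, having degrees `4` and `2` on its two sides.
Shifting `q` as well is essential: for `a = b` and `q ^ 2 = 1` a shift of `a` and `b` alone would
not help. -/
theorem eventually_mul_ne (q a b : ℂ) :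
    ∀ᶠ t in nhdsWithin (0 : ℂ) {0}ᶜ, (a + t) ^ 2 * (q + t) ^ 2 ≠ (b + t) ^ 2 := by
  let P : Polynomial ℂ := (Polynomial.X + Polynomial.C a) ^ 2 * (Polynomial.X + Polynomial.C q) ^ 2 -
    (Polynomial.X + Polynomial.C b) ^ 2
  have hP : P ≠ 0 := by
    have h1 : ((Polynomial.X + Polynomial.C a) ^ 2 *
        (Polynomial.X + Polynomial.C q) ^ 2 : Polynomial ℂ).natDegree = 4 := by
      compute_degree!
    have h2 : ((Polynomial.X + Polynomial.C b) ^ 2 : Polynomial ℂ).natDegree = 2 := by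
      compute_degree!
    intro h0
    rw [sub_eq_zero.1 h0] at h1
    lia
  have hfin : {t : ℂ | P.IsRoot t}.Finite := Polynomial.finite_setOfPred_isRoot hP
  have : ∀ᶠ t in nhdsWithin (0 : ℂ) {0}ᶜ, t ∉ {t : ℂ | P.IsRoot t} :=
    (nhdsNE_le_cofinite (0 : ℂ)) hfin.eventually_cofinite_notMem
  filter_upwards [this] with t ht e
  apply ht
  simp only [P, Polynomial.IsRoot, Polynomial.eval_sub, Polynomial.eval_mul,
    Polynomial.eval_pow, Polynomial.eval_add, Polynomial.eval_X, Polynomial.eval_C]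
  linear_combination e

theorem scalarProduct_sqrtWeights {q : ℂ} (hq : q ≠ 0) {n M : ℕ} {s : Fin n → ℂ}
    (hs : Function.Injective fun k => s k ^ 2) {p p' : Fin M → ℂ}
    (hpq : ∀ m k, p m ^ 2 * q ^ 2 ≠ s k ^ 2) (hps : ∀ m k, p m ^ 2 ≠ s k ^ 2)
    (hp : Function.Injective fun m => p m ^ 2)
    (hpq' : ∀ m k, p' m ^ 2 * q ^ 2 ≠ s k ^ 2) (hps' : ∀ m k, p' m ^ 2 ≠ s k ^ 2)
    (hp' : Function.Injective fun m => p' m ^ 2) :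
    scalarProduct (fun m k => sqrtWeights q (p m) (s k)) (fun m k => sqrtWeights q (p' m) (s k)) =
      q ^ (-((M : ℤ) * ((n : ℤ) - (M : ℤ)))) * ∑ l : Fin M → Fin n with StrictMono l,
        (∏ m : Fin M, ∏ j : Fin n with ∀ k, j ≠ l k,
            (s j ^ 2 * q ^ 2 - s (l m) ^ 2) / (s j ^ 2 - s (l m) ^ 2)) *
          sqrtIzergin q p (fun k => s (l k)) * sqrtIzergin q p' fun k => s (l k) := by
  -- The conditions `s j ^ 2 * q ^ 2 ≠ s k ^ 2` are needed for the basis only and enter no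
  -- denominator of either side, so both sides stay continuous at `t = 0`.
  let F : ℂ → ℂ := fun t => scalarProduct (fun m k => sqrtWeights (q + t) (p m) (s k + t))
    (fun m k => sqrtWeights (q + t) (p' m) (s k + t))
  let G : ℂ → ℂ := fun t =>
    (q + t) ^ (-((M : ℤ) * ((n : ℤ) - (M : ℤ)))) * ∑ l : Fin M → Fin n with StrictMono l,
        (∏ m : Fin M, ∏ j : Fin n with ∀ k, j ≠ l k,
            ((s j + t) ^ 2 * (q + t) ^ 2 - (s (l m) + t) ^ 2) /
              ((s j + t) ^ 2 - (s (l m) + t) ^ 2)) *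
          sqrtIzergin (q + t) p (fun k => s (l k) + t) *
            sqrtIzergin (q + t) p' fun k => s (l k) + t
  have hcq : ContinuousAt (fun t => q + t) 0 := by fun_prop
  have hcs (k : Fin n) : ContinuousAt (fun t => s k + t) 0 := by fun_prop
  have hw (x y : ℂ) (h : x ^ 2 * q ^ 2 ≠ y ^ 2) :
      ContinuousAt (fun t => bWeight (q + t) x (y + t)) 0 ∧
        ContinuousAt (fun t => cWeight (q + t) x (y + t)) 0 := by
    have h' : x ^ 2 * (q + 0) ^ 2 - (y + 0) ^ 2 ≠ 0 := by simpa [sub_eq_zero] using h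
    constructor <;>
    · simp only [bWeight, cWeight]
      fun_prop (disch := assumption)
  have hF : ContinuousAt F 0 := by
    apply continuousAt_scalarProduct
    · exact fun m k => ⟨(hw _ _ (hpq m k)).1, (hw _ _ (hpq m k)).1, (hw _ _ (hpq m k)).2,
        (hw _ _ (hpq m k)).2, continuousAt_const⟩
    · exact fun m k => ⟨(hw _ _ (hpq' m k)).1, (hw _ _ (hpq' m k)).1, (hw _ _ (hpq' m k)).2,
        (hw _ _ (hpq' m k)).2, continuousAt_const⟩
  have hG : ContinuousAt G 0 := by
    refine ContinuousAt.mul (ContinuousAt.zpow₀ hcq _ (Or.inl (by simpa using hq)))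
      (tendsto_finsetSum _ fun l hl => ?_)
    have hl' : Function.Injective l := (Finset.mem_filter.1 hl).2.injective
    have hsl : Function.Injective fun m => s (l m) ^ 2 := hs.comp hl'
    refine ContinuousAt.mul (ContinuousAt.mul (tendsto_finsetProd _ fun m _ =>
      tendsto_finsetProd _ fun j hj => ?_) ?_) ?_
    · refine ContinuousAt.div (by fun_prop) (by fun_prop) ?_
      simp only [add_zero]
      exact sub_ne_zero.2 fun e => (Finset.mem_filter.1 hj).2 m (hs e)
    · exact continuousAt_sqrtIzergin hcq (fun _ => continuousAt_const) (fun _ => hcs _) hp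
        (by simpa using hsl) (by simpa using fun m k => hps m (l k))
        (by simpa using fun m k => hpq m (l k))
    · exact continuousAt_sqrtIzergin hcq (fun _ => continuousAt_const) (fun _ => hcs _) hp'
        (by simpa using hsl) (by simpa using fun m k => hps' m (l k))
        (by simpa using fun m k => hpq' m (l k))
  have hne {f g : ℂ → ℂ} (hf : ContinuousAt f 0) (hg : ContinuousAt g 0) (h : f 0 ≠ g 0) :
      ∀ᶠ t in nhdsWithin (0 : ℂ) {0}ᶜ, f t ≠ g t :=
    ((hf.ne_iff_eventually_ne hg).1 h).filter_mono nhdsWithin_le_nhds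
  have hFG : F =ᶠ[nhdsWithin 0 {0}ᶜ] G := by
    have e1 : ∀ᶠ t in nhdsWithin (0 : ℂ) {0}ᶜ, q + t ≠ 0 :=
      hne hcq continuousAt_const (by simpa using hq)
    have e2 : ∀ᶠ t in nhdsWithin (0 : ℂ) {0}ᶜ, ∀ j k, j ≠ k → (s j + t) ^ 2 ≠ (s k + t) ^ 2 := by
      simp only [Filter.eventually_all]
      exact fun j k hjk => hne ((hcs j).pow 2) ((hcs k).pow 2) (by simpa using fun e => hjk (hs e))
    have e3 : ∀ᶠ t in nhdsWithin (0 : ℂ) {0}ᶜ, ∀ j k,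
        (s j + t) ^ 2 * (q + t) ^ 2 ≠ (s k + t) ^ 2 := by
      simp only [Filter.eventually_all]
      exact fun j k => eventually_mul_ne _ _ _
    have e4 (x : Fin M → ℂ) (hx : ∀ m k, x m ^ 2 * q ^ 2 ≠ s k ^ 2) :
        ∀ᶠ t in nhdsWithin (0 : ℂ) {0}ᶜ, ∀ m k, x m ^ 2 * (q + t) ^ 2 ≠ (s k + t) ^ 2 := by
      simp only [Filter.eventually_all]
      exact fun m k => hne (continuousAt_const.mul (hcq.pow 2)) ((hcs k).pow 2)
        (by simpa using hx m k)
    have e5 (x : Fin M → ℂ) (hx : ∀ m k, x m ^ 2 ≠ s k ^ 2) :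
        ∀ᶠ t in nhdsWithin (0 : ℂ) {0}ᶜ, ∀ m k, x m ^ 2 ≠ (s k + t) ^ 2 := by
      simp only [Filter.eventually_all]
      exact fun m k => hne continuousAt_const ((hcs k).pow 2) (by simpa using hx m k)
    filter_upwards [e1, e2, e3, e4 p hpq, e4 p' hpq', e5 p hps, e5 p' hps'] with t h1 h2 h3 h4 h5 h6
      h7
    exact scalarProduct_sqrtWeights_of_generic (s := fun k => s k + t) ⟨h1, h2, h3⟩ h4 h6 hp h5 h7
      hp'
  have h0 : F 0 = G 0 := tendsto_nhds_unique
    ((hF.tendsto.mono_left nhdsWithin_le_nhds).congr' hFG) (hG.tendsto.mono_left nhdsWithin_le_nhds)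
  simpa only [F, G, add_zero] using h0

end SixVertex

end

theorem mainTheorem7 (r : ℂ → ℂ) (hr : ∀ u, r u ^ 2 = u) (L M : ℕ) (hML : M ≤ L)
    (ρ : ℂ) (hρ : ρ ≠ 0) (ξ z : Fin L → ℂ) (μ x ν y : Fin M → ℂ)
    (hx : ∀ m, x m ≠ 0) (hy : ∀ m, y m ≠ 0)
    (hμ : ∀ m k, μ m * ρ ≠ ξ k) (hν : ∀ m k, ν m * ρ ≠ ξ k) :
    SixVertex.fieldScalarProduct r ρ ξ z μ x ν y =
        (∏ l, z l ^ M) /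
            (∏ m : Fin M, (r (x m) * r (y m)) ^ (2 * (L : ℤ) + 1 - 2 * ((m : ℤ) + 1))) *
          SixVertex.symScalarProduct r ρ ξ μ ν ∧
      (Function.Injective ξ → Function.Injective μ → Function.Injective ν →
        (∀ m k, μ m ≠ ξ k) → (∀ m k, ν m ≠ ξ k) →
        SixVertex.symScalarProduct r ρ ξ μ ν =
          r ρ ^ (-((M : ℤ) * ((L : ℤ) - (M : ℤ)))) *
            ∑ l : Fin M → Fin L with StrictMono l,
              (∏ m : Fin M, ∏ n : Fin L with ∀ k, n ≠ l k,
                  (ξ n * ρ - ξ (l m)) / (ξ n - ξ (l m))) *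
                SixVertex.izergin r ρ μ (fun k => ξ (l k)) *
                SixVertex.izergin r ρ ν (fun k => ξ (l k))) := by
  refine ⟨SixVertex.fieldScalarProduct_eq hr ρ ξ z μ x ν y hx hy, fun hξ hμi hνi hμξ hνξ => ?_⟩
  have hq : r ρ ≠ 0 := fun h => hρ (by rw [← hr ρ, h]; simp)
  have key := SixVertex.scalarProduct_sqrtWeights hq (s := fun k => r (ξ k))
    (p := fun m => r (μ m)) (p' := fun m => r (ν m)) (by simpa only [hr] using hξ)
    (by simpa only [hr] using hμ) (by simpa only [hr] using hμξ) (by simpa only [hr] using hμi)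
    (by simpa only [hr] using hν) (by simpa only [hr] using hνξ) (by simpa only [hr] using hνi)
  simp only [SixVertex.symScalarProduct, SixVertex.symWeights_eq_sqrtWeights hr,
    SixVertex.izergin_eq_sqrtIzergin hr]
  simpa only [hr] using key
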